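/- Let $n\ge 1$, let $Q_0=\{1,\dots,n\}$, and let $(a_{ij})$ be the Cartan matrix of type $A_n$, i.e. $a_{ii}=2$, $a_{ij}=-1$ if $|i-j|=1$ and $a_{ij}=0$ if $|i-j|\ge 2$; write $(\alpha_i,\alpha_j)=a_{ij}$. *The quantum group.* Let $U_v(\mathfrak g)$, $\mathfrak g=\mathfrak{sl}_{n+1}$, be the $\mathbb Q(v)$-algebra with generators $E_i,F_i,K_i,K_i^{-1}$ ($i\in Q_0$) and relations $K_iK_j=K_jK_i$, $K_iK_i^{-1}=K_i^{-1}K_i=1$, $K_iE_jK_i^{-1}=v^{a_{ij}}E_j$, $K_iF_jK_i^{-1}=v^{-a_{ij}}F_j$, $E_iF_j-F_jE_i=\delta_{ij}\frac{K_i-K_i^{-1}}{v-v^{-1}}$; $E_i^2E_j-(v+v^{-1})E_iE_jE_i+E_jE_i^2=0$ and $F_i^2F_j-(v+v^{-1})F_iF_jF_i+F_jF_i^2=0$ for $|i-j|=1$; $E_iE_j=E_jE_i$ and $F_iF_j=F_jF_i$ for $|i-j|\ge 2$. Let $U_v(\mathfrak n)$ be the subalgebra generated by $E_1,\dots,E_n$.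 For $i\in Q_0$ let $T_i$ be Lusztig's automorphism of $U_v(\mathfrak g)$: $T_i(E_i)=-K_i^{-1}F_i$, $T_i(F_i)=-E_iK_i$; $T_i(E_j)=E_jE_i-v^{-1}E_iE_j$, $T_i(F_j)=F_iF_j-vF_jF_i$ for $|i-j|=1$; $T_i(E_j)=E_j$, $T_i(F_j)=F_j$ for $|i-j|\ge 2$; and $T_i(K_j)=K_jK_i^{-a_{ij}}$ for all $j$. For $1\le i\le j\le n$ put $$X_{i,j}=T_i^{(-1)^{i-1}}T_{i+1}^{(-1)^{i}}\cdots T_{j-1}^{(-1)^{j-2}}(E_j).$$ *The quantum shuffle algebra.* Let $\mathcal F$ be the $\mathbb Q(v)$-vector space with basis the symbols $w[i_1,\dots,i_r]$ ($r\ge 0$, $i_k\in Q_0$), with the bilinear product $$w[i_1,\dots,i_r]*w[i_{r+1},\dots,i_{r+s}]=\sum_{\pi}v^{e(\pi)}\,w[i_{\pi^{-1}(1)},\dots,i_{\pi^{-1}(r+s)}],\qquad e(\pi)=\sum_{k\le r<l,\ \pi(k)<\pi(l)}(\alpha_{i_k},\alpha_{i_l}),$$ where $\pi$ runs over the permutations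 in $S_{r+s}$ with $\pi(1)<\dots<\pi(r)$ and $\pi(r+1)<\dots<\pi(r+s)$. This is an associative unital algebra, and there is a unique homomorphism of unital $\mathbb Q(v)$-algebras $\Phi\colon U_v(\mathfrak n)\to\mathcal F$ with $\Phi(E_i)=w[i]$ for all $i\in Q_0$ (the map by which $U_v(\mathfrak n)$ is embedded into $\mathcal F$). **Lemma.** Let $1\le i\le j\le n$. Then $X_{i,j}\in U_v(\mathfrak n)$ and $$\Phi(X_{i,j})=(1-v^{-2})^{j-i}\sum_{\pi}w[\pi(i),\pi(i+1),\dots,\pi(j)],$$ where the sum runs over all permutations $\pi$ of $\{i,i+1,\dots,j\}$ such that $\pi^{-1}(k)>\pi^{-1}(k+1)$ for every even $k$ with $i\le k\le j-1$, and $\pi^{-1}(k)>\pi^{-1}(k-1)$ for every even $k$ with $i+1\le k\le j$. -/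

import Mathlib

set_option linter.unusedSimpArgs false

noncomputable section

namespace QuantumShuffle

/-!
Main definitions, in this order; everything else is proof that they are well defined.
* `ShuffleAlgebra n`, with the product given by `shuffleSum`: the quantum shuffle algebra `F`;
  `ShuffleAlgebra.word u` is the symbol `w[u]`.
* `QuantumGroup n`: the algebra `U_v(g)` for `g = sl_{n+1}`, by generators and relations (`Rel`).
* `QuantumGroup.T i`: the automorphism `T_i` with the values `TE i j`, `TF i j`, `TK i j` at the
  generators (`T_E`, `T_F`, `T_K`).
* `QuantumGroup.positivePart n`: the subalgebra `U_v(n)`.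
* `shuffleHom n`: the unique algebra homomorphism `U_v(n) → F` with `E_i ↦ w[i]`
  (`shuffleHom_E`, `shuffleHom_unique`).
* `X i j`, `alternatingPerms i j`, `permSeq π`: the terms of the formula.
-/

/-- The ground field `ℚ(v)` of rational functions. -/
def Qv : Type := RatFunc ℚ

instance : Field Qv := inferInstanceAs (Field (RatFunc ℚ))

/-- The indeterminate `v`. -/
def v : Qv := (RatFunc.X : RatFunc ℚ)

/-- The vertices `1, 2, …, n` of the Dynkin diagram of type `A_n`. -/
abbrev Vertex (n : ℕ) : Type := ↥(Finset.Icc 1 n)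

variable {n : ℕ}

/-- The vertices `i`, `j` are neighbours: `|i - j| = 1`. -/
def Adj (i j : Vertex n) : Prop := |((i : ℕ) : ℤ) - ((j : ℕ) : ℤ)| = 1

/-- The vertices `i`, `j` are distinct and not neighbours: `|i - j| ≥ 2`. -/
def Far (i j : Vertex n) : Prop := 2 ≤ |((i : ℕ) : ℤ) - ((j : ℕ) : ℤ)|

open Classical in
/-- The entries of the Cartan matrix of type `A_n`. -/
def cartan (i j : Vertex n) : ℤ := if i = j then 2 else if Adj i j then -1 else 0

lemma adj_comm {i j : Vertex n} : Adj i j ↔ Adj j i := by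
  unfold Adj; rw [abs_sub_comm]

lemma far_comm {i j : Vertex n} : Far i j ↔ Far j i := by
  unfold Far; rw [abs_sub_comm]

lemma Far.ne {i j : Vertex n} (h : Far i j) : i ≠ j := by
  rintro rfl; simp [Far] at h

lemma Adj.ne {i j : Vertex n} (h : Adj i j) : i ≠ j := by
  rintro rfl; simp [Adj] at h

lemma Far.not_adj {i j : Vertex n} (h : Far i j) : ¬ Adj i j := by
  unfold Far at h; unfold Adj; omega

lemma far_of {i j : Vertex n} (h1 : i ≠ j) (h2 : ¬ Adj i j) : Far i j := by
  have : (i : ℕ) ≠ j := fun h => h1 (Subtype.ext h)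
  unfold Far; unfold Adj at h2
  rcases abs_cases (((i : ℕ) : ℤ) - ((j : ℕ) : ℤ)) with h | h <;> omega

lemma far_of_adj_adj {i j k : Vertex n} (h1 : Adj i j) (h2 : Adj i k) (h : j ≠ k) : Far j k := by
  have : (j : ℕ) ≠ k := fun h' => h (Subtype.ext h')
  unfold Far; unfold Adj at h1 h2
  rcases abs_cases (((i : ℕ) : ℤ) - ((j : ℕ) : ℤ)) with h | h <;>
  rcases abs_cases (((i : ℕ) : ℤ) - ((k : ℕ) : ℤ)) with h' | h' <;>
  rcases abs_cases (((j : ℕ) : ℤ) - ((k : ℕ) : ℤ)) with h'' | h'' <;> omega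

@[simp] lemma cartan_self (i : Vertex n) : cartan i i = 2 := by simp [cartan]

lemma cartan_adj {i j : Vertex n} (h : Adj i j) : cartan i j = -1 := by
  simp [cartan, h, h.ne]

lemma cartan_far {i j : Vertex n} (h : Far i j) : cartan i j = 0 := by
  simp [cartan, h.ne, h.not_adj]

lemma cartan_comm (i j : Vertex n) : cartan i j = cartan j i := by
  rcases eq_or_ne i j with rfl | h
  · rfl
  · by_cases h' : Adj i j
    · rw [cartan_adj h', cartan_adj (adj_comm.1 h')]
    · rw [cartan_far (far_of h h'), cartan_far (far_comm.1 (far_of h h'))]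

lemma v_ne_zero : v ≠ 0 := RatFunc.X_ne_zero (K := ℚ)

lemma v_sq_ne : v ^ 2 + 1 ≠ 0 := by
  have h : (Polynomial.X ^ 2 + 1 : Polynomial ℚ) ≠ 0 := by
    intro h
    have := congrArg (Polynomial.eval 0) h
    simp at this
  have h2 := (map_ne_zero_iff (algebraMap (Polynomial ℚ) (RatFunc ℚ))
    (RatFunc.algebraMap_injective ℚ)).2 h
  have h3 : (RatFunc.X ^ 2 + 1 : RatFunc ℚ) ≠ 0 := by simpa using h2
  exact h3

lemma v_sq_ne' : v ^ 2 - 1 ≠ 0 := by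
  have h : (Polynomial.X ^ 2 - 1 : Polynomial ℚ) ≠ 0 := by
    intro h
    have := congrArg (Polynomial.eval 0) h
    simp at this
  have h2 := (map_ne_zero_iff (algebraMap (Polynomial ℚ) (RatFunc ℚ))
    (RatFunc.algebraMap_injective ℚ)).2 h
  have h3 : (RatFunc.X ^ 2 - 1 : RatFunc ℚ) ≠ 0 := by simpa using h2
  exact h3

lemma v_sub_ne : v - v⁻¹ ≠ 0 := by
  intro h
  have h0 := v_ne_zero
  apply v_sq_ne'
  field_simp at h
  linear_combination h

/-! ### The quantum shuffle algebra -/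

/-- The underlying vector space of the quantum shuffle algebra: the `ℚ(v)`-vector space whose basis
consists of all finite sequences of vertices. -/
def ShuffleAlgebra (n : ℕ) : Type := List (Vertex n) →₀ Qv

namespace ShuffleAlgebra

instance : AddCommGroup (ShuffleAlgebra n) :=
  inferInstanceAs (AddCommGroup (List (Vertex n) →₀ Qv))

instance : Module Qv (ShuffleAlgebra n) :=
  inferInstanceAs (Module Qv (List (Vertex n) →₀ Qv))

/-- The basis of the symbols `w[i_1, …, i_r]`. -/
def basis (n : ℕ) : Module.Basis (List (Vertex n)) Qv (ShuffleAlgebra n) :=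
  Finsupp.basisSingleOne

/-- The symbol `w[i_1, …, i_r]`. -/
def word (u : List (Vertex n)) : ShuffleAlgebra n := basis n u

/-- The sequences `u` of length `r` and `w` of length `s` are merged into one sequence of length
`N`; `π` prescribes the new position of every letter. It is a shuffle of type `(r, s)` if it keeps
the order of the letters of `u` and the order of the letters of `w`. -/
def IsShuffle {r s N : ℕ} (π : Fin r ⊕ Fin s ≃ Fin N) : Prop :=
  StrictMono (fun k => π (Sum.inl k)) ∧ StrictMono (fun l => π (Sum.inr l))

/-- The exponent `e(π)`: the sum of `(α_a, α_b)` over all pairs of a letter `a` of `u` and a letter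
`b` of `w` such that `a` is placed before `b`. -/
def shuffleExp (u w : List (Vertex n)) {N : ℕ} (π : Fin u.length ⊕ Fin w.length ≃ Fin N) : ℤ :=
  ∑ k : Fin u.length, ∑ l : Fin w.length,
    if π (Sum.inl k) < π (Sum.inr l) then cartan (u.get k) (w.get l) else 0

/-- The sequence obtained from `u` and `w` by placing all letters as prescribed by `π`. -/
def shuffleWord (u w : List (Vertex n)) {N : ℕ} (π : Fin u.length ⊕ Fin w.length ≃ Fin N) :
    List (Vertex n) :=
  List.ofFn fun p => Sum.elim u.get w.get (π.symm p)

open Classical in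
/-- The sum over all shuffles `π` of `u` and `w` into a sequence of length `N` (there is none unless
`N` is the sum of the two lengths). -/
def shuffleSum (u w : List (Vertex n)) (N : ℕ) : ShuffleAlgebra n :=
  ∑ π : Fin u.length ⊕ Fin w.length ≃ Fin N,
    if IsShuffle π then v ^ shuffleExp u w π • word (shuffleWord u w π) else 0

/-- The quantum shuffle product, extended bilinearly from the basis. -/
def mulHom (n : ℕ) : ShuffleAlgebra n →ₗ[Qv] ShuffleAlgebra n →ₗ[Qv] ShuffleAlgebra n :=
  (basis n).constr Qv fun u => (basis n).constr Qv fun w => shuffleSum u w (u.length + w.length)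

instance : Mul (ShuffleAlgebra n) := ⟨fun x y => mulHom n x y⟩
instance : One (ShuffleAlgebra n) := ⟨word []⟩

lemma word_mul_word (u w : List (Vertex n)) :
    word u * word w = shuffleSum u w (u.length + w.length) := by
  change mulHom n (basis n u) (basis n w) = _
  simp [mulHom]

/-- Put a letter in front of all words. -/
def cons (a : Vertex n) : ShuffleAlgebra n →ₗ[Qv] ShuffleAlgebra n :=
  (basis n).constr Qv fun u => word (a :: u)

@[simp] lemma cons_word (a : Vertex n) (u : List (Vertex n)) : cons a (word u) = word (a :: u) := by
  simp [cons, word]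

/-- The pairing of a simple root with the degree of a word. -/
def pair (a : Vertex n) (u : List (Vertex n)) : ℤ := (u.map (cartan a)).sum

def scale (a : Vertex n) : ShuffleAlgebra n →ₗ[Qv] ShuffleAlgebra n :=
  (basis n).constr Qv fun u => v ^ pair a u • word u

@[simp] lemma scale_word (a : Vertex n) (u : List (Vertex n)) :
    scale a (word u) = v ^ pair a u • word u := by
  simp [scale, word]

def extL {r s N : ℕ} (π : Fin r ⊕ Fin s ≃ Fin N) : Fin (r + 1) ⊕ Fin s ≃ Fin (N + 1) where
  toFun := Sum.elim (Fin.cases 0 fun k => (π (Sum.inl k)).succ) fun l => (π (Sum.inr l)).succ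
  invFun := Fin.cases (Sum.inl 0) fun p => Sum.map Fin.succ id (π.symm p)
  left_inv := by
    rintro (k | l)
    · refine Fin.cases ?_ (fun k => ?_) k <;> simp
    · simp
  right_inv := by
    intro p
    refine Fin.cases ?_ (fun p => ?_) p
    · simp
    · obtain ⟨q, rfl⟩ := π.surjective p
      rcases q with k | l <;> simp

def extR {r s N : ℕ} (π : Fin r ⊕ Fin s ≃ Fin N) : Fin r ⊕ Fin (s + 1) ≃ Fin (N + 1) where
  toFun := Sum.elim (fun k => (π (Sum.inl k)).succ) (Fin.cases 0 fun l => (π (Sum.inr l)).succ)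
  invFun := Fin.cases (Sum.inr 0) fun p => Sum.map id Fin.succ (π.symm p)
  left_inv := by
    rintro (k | l)
    · simp
    · refine Fin.cases ?_ (fun k => ?_) l <;> simp
  right_inv := by
    intro p
    refine Fin.cases ?_ (fun p => ?_) p
    · simp
    · obtain ⟨q, rfl⟩ := π.surjective p
      rcases q with k | l <;> simp

lemma exists_extL {r s N : ℕ} (π : Fin (r + 1) ⊕ Fin s ≃ Fin (N + 1)) (h : π (Sum.inl 0) = 0) :
    ∃ ρ : Fin r ⊕ Fin s ≃ Fin N, extL ρ = π := by
  have h0 : ∀ x, π (Sum.map Fin.succ id x) ≠ 0 := by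
    intro x hx
    have := π.injective (hx.trans h.symm)
    rcases x with k | l <;> simp at this
  have hs : ∀ p : Fin N, ∃ x, Sum.map Fin.succ id x = π.symm p.succ := by
    intro p
    rcases hq : π.symm p.succ with k | l
    · refine Fin.cases (fun hk => ?_) (fun k _ => ⟨Sum.inl k, rfl⟩) k hq
      have := (Equiv.symm_apply_eq _).1 hk
      rw [h] at this
      exact absurd this (Fin.succ_ne_zero p)
    · exact ⟨Sum.inr l, rfl⟩
  let g : Fin r ⊕ Fin s → Fin N := fun x => (π (Sum.map Fin.succ id x)).pred (h0 x)
  have hg : Function.Bijective g := by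
    constructor
    · intro x y hxy
      have := π.injective (Fin.pred_inj.1 hxy)
      exact Function.Injective.sumMap (Fin.succ_injective r) Function.injective_id this
    · intro p
      obtain ⟨x, hx⟩ := hs p
      exact ⟨x, by simp [g, hx]⟩
  refine ⟨Equiv.ofBijective g hg, ?_⟩
  ext x : 1
  rcases x with k | l
  · refine Fin.cases ?_ (fun k => ?_) k
    · simp [extL, h]
    · simp [extL, g]
  · simp [extL, g]

lemma exists_extR {r s N : ℕ} (π : Fin r ⊕ Fin (s + 1) ≃ Fin (N + 1)) (h : π (Sum.inr 0) = 0) :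
    ∃ ρ : Fin r ⊕ Fin s ≃ Fin N, extR ρ = π := by
  have h0 : ∀ x, π (Sum.map id Fin.succ x) ≠ 0 := by
    intro x hx
    have := π.injective (hx.trans h.symm)
    rcases x with k | l <;> simp at this
  have hs : ∀ p : Fin N, ∃ x, Sum.map id Fin.succ x = π.symm p.succ := by
    intro p
    rcases hq : π.symm p.succ with k | l
    · exact ⟨Sum.inl k, rfl⟩
    · refine Fin.cases (fun hk => ?_) (fun k _ => ⟨Sum.inr k, rfl⟩) l hq
      have := (Equiv.symm_apply_eq _).1 hk
      rw [h] at this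
      exact absurd this (Fin.succ_ne_zero p)
  let g : Fin r ⊕ Fin s → Fin N := fun x => (π (Sum.map id Fin.succ x)).pred (h0 x)
  have hg : Function.Bijective g := by
    constructor
    · intro x y hxy
      have := π.injective (Fin.pred_inj.1 hxy)
      exact Function.Injective.sumMap Function.injective_id (Fin.succ_injective s) this
    · intro p
      obtain ⟨x, hx⟩ := hs p
      exact ⟨x, by simp [g, hx]⟩
  refine ⟨Equiv.ofBijective g hg, ?_⟩
  ext x : 1
  rcases x with k | l
  · simp [extR, g]
  · refine Fin.cases ?_ (fun k => ?_) l
    · simp [extR, h]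
    · simp [extR, g]

lemma extL_injective {r s N : ℕ} :
    Function.Injective (extL : (Fin r ⊕ Fin s ≃ Fin N) → _) := by
  intro π ρ h
  ext x : 1
  have := DFunLike.congr_fun h (Sum.map Fin.succ id x)
  rcases x with k | l <;> simpa [extL] using this

lemma extR_injective {r s N : ℕ} :
    Function.Injective (extR : (Fin r ⊕ Fin s ≃ Fin N) → _) := by
  intro π ρ h
  ext x : 1
  have := DFunLike.congr_fun h (Sum.map id Fin.succ x)
  rcases x with k | l <;> simpa [extR] using this

lemma isShuffle_extL {r s N : ℕ} (π : Fin r ⊕ Fin s ≃ Fin N) :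
    IsShuffle (extL π) ↔ IsShuffle π := by
  unfold IsShuffle
  refine and_congr ?_ ?_
  · constructor
    · intro h a b hab
      simpa [extL] using h (Fin.succ_lt_succ_iff.2 hab)
    · intro h a b
      refine Fin.cases ?_ (fun a => ?_) a <;> refine Fin.cases ?_ (fun b => ?_) b
      · simp
      · simp [extL]
      · simp
      · simpa [extL] using @h a b
  · constructor <;> intro h a b hab <;> simpa [extL] using h hab

lemma isShuffle_extR {r s N : ℕ} (π : Fin r ⊕ Fin s ≃ Fin N) :
    IsShuffle (extR π) ↔ IsShuffle π := by
  unfold IsShuffle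
  refine and_congr ?_ ?_
  · constructor <;> intro h a b hab <;> simpa [extR] using h hab
  · constructor
    · intro h a b hab
      simpa [extR] using h (Fin.succ_lt_succ_iff.2 hab)
    · intro h a b
      refine Fin.cases ?_ (fun a => ?_) a <;> refine Fin.cases ?_ (fun b => ?_) b
      · simp
      · simp [extR]
      · simp
      · simpa [extR] using @h a b

lemma shuffleWord_extL (a : Vertex n) (u w : List (Vertex n)) {N : ℕ}
    (π : Fin u.length ⊕ Fin w.length ≃ Fin N) :
    shuffleWord (a :: u) w (extL π) = a :: shuffleWord u w π := by
  unfold shuffleWord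
  rw [List.ofFn_succ]
  congr 2
  funext p
  change Sum.elim _ _ (Sum.map Fin.succ id (π.symm p)) = _
  rcases π.symm p with k | l <;> simp

lemma shuffleWord_extR (b : Vertex n) (u w : List (Vertex n)) {N : ℕ}
    (π : Fin u.length ⊕ Fin w.length ≃ Fin N) :
    shuffleWord u (b :: w) (extR π) = b :: shuffleWord u w π := by
  unfold shuffleWord
  rw [List.ofFn_succ]
  congr 2
  funext p
  change Sum.elim _ _ (Sum.map id Fin.succ (π.symm p)) = _
  rcases π.symm p with k | l <;> simp

lemma pair_eq_sum (a : Vertex n) (w : List (Vertex n)) :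
    pair a w = ∑ l : Fin w.length, cartan a (w.get l) := by
  rw [pair, ← List.sum_ofFn]
  congr 1
  conv_lhs => rw [← List.ofFn_get w, List.map_ofFn]
  rfl

lemma shuffleExp_extL (a : Vertex n) (u w : List (Vertex n)) {N : ℕ}
    (π : Fin u.length ⊕ Fin w.length ≃ Fin N) :
    shuffleExp (a :: u) w (extL π) = pair a w + shuffleExp u w π := by
  unfold shuffleExp
  refine (Fin.sum_univ_succ (n := u.length) _).trans ?_
  rw [pair_eq_sum]
  simp [extL]

lemma shuffleExp_extR (b : Vertex n) (u w : List (Vertex n)) {N : ℕ}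
    (π : Fin u.length ⊕ Fin w.length ≃ Fin N) :
    shuffleExp u (b :: w) (extR π) = shuffleExp u w π := by
  unfold shuffleExp
  refine Finset.sum_congr rfl fun k _ => ?_
  refine (Fin.sum_univ_succ (n := w.length) _).trans ?_
  simp [extR]

open Classical in
lemma sumL (a : Vertex n) (u w : List (Vertex n)) (N : ℕ) :
    (∑ π : Fin (a :: u).length ⊕ Fin w.length ≃ Fin (N + 1), if π (Sum.inl 0) = 0 then
      (if IsShuffle π then v ^ shuffleExp (a :: u) w π • word (shuffleWord (a :: u) w π) else 0)
        else 0) = v ^ pair a w • cons a (shuffleSum u w N) := by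
  rw [← Finset.sum_filter, shuffleSum, map_sum, Finset.smul_sum]
  symm
  refine Finset.sum_bij (fun π _ => extL π) ?_ (fun _ _ _ _ h => extL_injective h) ?_ ?_
  · intro π _
    simp [extL]
  · intro π hπ
    obtain ⟨ρ, hρ⟩ := exists_extL π (by simpa using hπ)
    exact ⟨ρ, Finset.mem_univ _, hρ⟩
  · intro π _
    have := isShuffle_extL π
    by_cases h : IsShuffle π
    · rw [if_pos h, if_pos (this.2 h), shuffleExp_extL, shuffleWord_extL, zpow_add₀ v_ne_zero]
      simp [smul_smul]
    · rw [if_neg h, if_neg (fun h' => h (this.1 h'))]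
      simp

open Classical in
lemma sumR (b : Vertex n) (u w : List (Vertex n)) (N : ℕ) :
    (∑ π : Fin u.length ⊕ Fin (b :: w).length ≃ Fin (N + 1), if π (Sum.inr 0) = 0 then
      (if IsShuffle π then v ^ shuffleExp u (b :: w) π • word (shuffleWord u (b :: w) π) else 0)
        else 0) = cons b (shuffleSum u w N) := by
  rw [← Finset.sum_filter, shuffleSum, map_sum]
  symm
  refine Finset.sum_bij (fun π _ => extR π) ?_ (fun _ _ _ _ h => extR_injective h) ?_ ?_
  · intro π _
    simp [extR]
  · intro π hπ
    obtain ⟨ρ, hρ⟩ := exists_extR π (by simpa using hπ)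
    exact ⟨ρ, Finset.mem_univ _, hρ⟩
  · intro π _
    have := isShuffle_extR π
    by_cases h : IsShuffle π
    · rw [if_pos h, if_pos (this.2 h), shuffleExp_extR, shuffleWord_extR]
      simp
    · rw [if_neg h, if_neg (fun h' => h (this.1 h'))]
      simp

lemma shuffleSum_nil_nil : shuffleSum ([] : List (Vertex n)) [] 0 = word [] := by
  have : IsEmpty (Fin ([] : List (Vertex n)).length) := Fin.isEmpty
  have hu : ∀ π : Fin ([] : List (Vertex n)).length ⊕ Fin ([] : List (Vertex n)).length ≃ Fin 0,
      π = Equiv.equivOfIsEmpty _ _ := fun π => Equiv.ext fun x => (π x).elim0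
  unfold shuffleSum
  rw [Fintype.sum_eq_single (Equiv.equivOfIsEmpty _ _) fun π h => absurd (hu π) h]
  rw [if_pos ⟨fun a => a.elim0, fun a => a.elim0⟩]
  simp [shuffleExp, shuffleWord]

lemma IsShuffle.zero_left {r s N : ℕ} {π : Fin (r + 1) ⊕ Fin s ≃ Fin (N + 1)} (h : IsShuffle π)
    {k : Fin (r + 1)} (hk : π (Sum.inl k) = 0) : π (Sum.inl 0) = 0 := by
  have := h.1.monotone (Fin.zero_le k)
  simp only [hk] at this
  exact Fin.le_zero_iff.1 this

lemma IsShuffle.zero_right {r s N : ℕ} {π : Fin r ⊕ Fin (s + 1) ≃ Fin (N + 1)} (h : IsShuffle π)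
    {k : Fin (s + 1)} (hk : π (Sum.inr k) = 0) : π (Sum.inr 0) = 0 := by
  have := h.2.monotone (Fin.zero_le k)
  simp only [hk] at this
  exact Fin.le_zero_iff.1 this

lemma shuffleSum_nil_cons (b : Vertex n) (w : List (Vertex n)) (N : ℕ) :
    shuffleSum [] (b :: w) (N + 1) = cons b (shuffleSum [] w N) := by
  rw [← sumR, shuffleSum]
  refine Finset.sum_congr rfl fun π _ => ?_
  by_cases h : IsShuffle π
  · obtain ⟨q | q, hq⟩ := π.surjective 0
    · exact q.elim0
    · rw [if_pos (h.zero_right hq)]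
  · simp [h]

lemma shuffleSum_cons_nil (a : Vertex n) (u : List (Vertex n)) (N : ℕ) :
    shuffleSum (a :: u) [] (N + 1) = cons a (shuffleSum u [] N) := by
  have := sumL a u [] N
  simp only [pair, List.map_nil, List.sum_nil, zpow_zero, one_smul] at this
  rw [← this, shuffleSum]
  refine Finset.sum_congr rfl fun π _ => ?_
  by_cases h : IsShuffle π
  · obtain ⟨q | q, hq⟩ := π.surjective 0
    · rw [if_pos (h.zero_left hq)]
    · exact q.elim0
  · simp [h]

lemma shuffleSum_cons_cons (a b : Vertex n) (u w : List (Vertex n)) (N : ℕ) :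
    shuffleSum (a :: u) (b :: w) (N + 1) =
      v ^ pair a (b :: w) • cons a (shuffleSum u (b :: w) N) + cons b (shuffleSum (a :: u) w N) := by
  rw [← sumL, ← sumR, shuffleSum, ← Finset.sum_add_distrib]
  refine Finset.sum_congr rfl fun π _ => ?_
  by_cases h : IsShuffle π
  · obtain ⟨q | q, hq⟩ := π.surjective 0
    · have h0 := h.zero_left hq
      have h1 : π (Sum.inr 0) ≠ 0 := fun h1 => by
        have := π.injective (h1.trans h0.symm)
        simp at this
      rw [if_pos h0, if_neg h1, add_zero]
    · have h0 := h.zero_right hq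
      have h1 : π (Sum.inl 0) ≠ 0 := fun h1 => by
        have := π.injective (h1.trans h0.symm)
        simp at this
      rw [if_pos h0, if_neg h1, zero_add]
  · simp [h]

lemma nil_mul_word (w : List (Vertex n)) : word [] * word w = word w := by
  rw [word_mul_word]
  induction w with
  | nil => exact shuffleSum_nil_nil
  | cons b w ih =>
    have : ([] : List (Vertex n)).length + (b :: w).length
      = (([] : List (Vertex n)).length + w.length) + 1 := rfl
    rw [this, shuffleSum_nil_cons, ih, cons_word]

lemma word_mul_nil (u : List (Vertex n)) : word u * word [] = word u := by
  rw [word_mul_word]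
  induction u with
  | nil => exact shuffleSum_nil_nil
  | cons a u ih =>
    have : (a :: u).length + ([] : List (Vertex n)).length
      = (u.length + ([] : List (Vertex n)).length) + 1 := by simp
    rw [this, shuffleSum_cons_nil, ih, cons_word]

lemma cons_mul_cons (a b : Vertex n) (u w : List (Vertex n)) :
    word (a :: u) * word (b :: w) =
      v ^ pair a (b :: w) • cons a (word u * word (b :: w)) + cons b (word (a :: u) * word w) := by
  simp only [word_mul_word]
  have h1 : (a :: u).length + (b :: w).length = (u.length + (b :: w).length) + 1 := by
    simp; omega
  have h2 : u.length + (b :: w).length = (a :: u).length + w.length := by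
    simp; omega
  rw [h1, shuffleSum_cons_cons, ← h2]

instance : NonUnitalNonAssocRing (ShuffleAlgebra n) where
  left_distrib x y z := map_add (mulHom n x) y z
  right_distrib x y z := by
    change mulHom n (x + y) z = mulHom n x z + mulHom n y z
    simp
  zero_mul x := by
    change mulHom n 0 x = 0
    simp
  mul_zero x := map_zero (mulHom n x)

instance : IsScalarTower Qv (ShuffleAlgebra n) (ShuffleAlgebra n) :=
  ⟨fun c x y => by change mulHom n (c • x) y = c • mulHom n x y; simp⟩

instance : SMulCommClass Qv (ShuffleAlgebra n) (ShuffleAlgebra n) :=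
  ⟨fun c x y => by change c • mulHom n x y = mulHom n x (c • y); simp⟩

lemma induction_word {P : ShuffleAlgebra n → Prop} (x : ShuffleAlgebra n)
    (hw : ∀ u, P (word u)) (h0 : P 0) (ha : ∀ x y, P x → P y → P (x + y))
    (hs : ∀ (c : Qv) x, P x → P (c • x)) : P x := by
  have hx : x ∈ Submodule.span Qv (Set.range (basis n)) := by simp [(basis n).span_eq]
  induction hx using Submodule.span_induction with
  | mem x h => obtain ⟨u, rfl⟩ := h; exact hw u
  | zero => exact h0
  | add x y _ _ hx hy => exact ha x y hx hy
  | smul c x _ hx => exact hs c x hx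

lemma cons_mul_cons' (a b : Vertex n) (x y : ShuffleAlgebra n) :
    cons a x * cons b y = cons a (x * scale a (cons b y)) + cons b (cons a x * y) := by
  induction x using induction_word with
  | hw u =>
    induction y using induction_word with
    | hw w => simp [cons_mul_cons, mul_smul_comm]
    | h0 => simp
    | ha y z hy hz => simp only [map_add, mul_add, hy, hz]; abel
    | hs c y hy => simp only [map_smul, mul_smul_comm, hy, smul_add]
  | h0 => simp
  | ha x z hx hz => simp only [map_add, add_mul, hx, hz]; abel
  | hs c x hx => simp only [map_smul, smul_mul_assoc, hx, smul_add]

lemma scale_cons (a b : Vertex n) (x : ShuffleAlgebra n) :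
    scale a (cons b x) = v ^ cartan a b • cons b (scale a x) := by
  induction x using induction_word with
  | hw u => simp [pair, zpow_add₀ v_ne_zero, smul_smul]
  | h0 => simp
  | ha x y hx hy => simp only [map_add, hx, hy, smul_add]
  | hs c x hx => simp only [map_smul, hx, smul_comm c]

lemma scale_mul_word (a : Vertex n) (u w : List (Vertex n)) :
    scale a (word u * word w) = scale a (word u) * scale a (word w) := by
  induction u generalizing w with
  | nil => simp [nil_mul_word, pair, mul_smul_comm]
  | cons b u ihu =>
    induction w with
    | nil => simp [word_mul_nil, pair, smul_mul_assoc]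
    | cons c w ihw =>
      rw [cons_mul_cons, map_add, map_smul, scale_cons, scale_cons, ihu, ihw]
      simp only [scale_word, smul_mul_assoc, mul_smul_comm, cons_mul_cons, map_smul, smul_add,
        smul_smul, pair, List.map_cons, List.sum_cons, zpow_add₀ v_ne_zero]
      congr 2 <;> ring

lemma scale_mul (a : Vertex n) (x y : ShuffleAlgebra n) :
    scale a (x * y) = scale a x * scale a y := by
  induction x using induction_word with
  | hw u =>
    induction y using induction_word with
    | hw w => exact scale_mul_word a u w
    | h0 => simp
    | ha y z hy hz => simp only [map_add, mul_add, hy, hz]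
    | hs c y hy => simp only [map_smul, mul_smul_comm, hy]
  | h0 => simp
  | ha x z hx hz => simp only [map_add, add_mul, hx, hz]
  | hs c x hx => simp only [map_smul, smul_mul_assoc, hx]

lemma one_mul_aux (x : ShuffleAlgebra n) : word [] * x = x := by
  induction x using induction_word with
  | hw u => exact nil_mul_word u
  | h0 => simp
  | ha x y hx hy => rw [mul_add, hx, hy]
  | hs c x hx => rw [mul_smul_comm, hx]

lemma mul_one_aux (x : ShuffleAlgebra n) : x * word [] = x := by
  induction x using induction_word with
  | hw u => exact word_mul_nil u
  | h0 => simp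
  | ha x y hx hy => rw [add_mul, hx, hy]
  | hs c x hx => rw [smul_mul_assoc, hx]

lemma assoc_word (x y z : List (Vertex n)) :
    word x * word y * word z = word x * (word y * word z) := by
  induction x generalizing y z with
  | nil => simp only [one_mul_aux]
  | cons a x ihx =>
    induction y generalizing z with
    | nil => simp only [one_mul_aux, mul_one_aux]
    | cons b y ihy =>
      induction z with
      | nil => simp only [mul_one_aux]
      | cons c z ihz =>
        have h1 : word x * scale a (word (b :: y)) * scale a (word (c :: z))
            = word x * (scale a (word (b :: y)) * scale a (word (c :: z))) := by
          simp only [scale_word, mul_smul_comm, smul_mul_assoc, ihx]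
        have h2 : word (a :: x) * word y * scale b (word (c :: z))
            = word (a :: x) * (word y * scale b (word (c :: z))) := by
          simp only [scale_word, mul_smul_comm, ihy]
        have hxy := cons_mul_cons' a b (word x) (word y)
        have hyz := cons_mul_cons' b c (word y) (word z)
        simp only [cons_word] at hxy hyz
        rw [← cons_word c z] at h1 h2 ⊢
        rw [hxy, add_mul, cons_mul_cons', cons_mul_cons', h1, h2, cons_word, hyz, mul_add]
        rw [← cons_word a x, cons_mul_cons', cons_mul_cons', cons_word a x]
        rw [← scale_mul, hyz, ← ihz, hxy, add_mul]
        simp only [map_add, mul_add]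
        abel

instance : Ring (ShuffleAlgebra n) :=
  { (inferInstance : NonUnitalNonAssocRing (ShuffleAlgebra n)) with
    one := 1
    one_mul := one_mul_aux
    mul_one := mul_one_aux
    mul_assoc := by
      intro x y z
      induction x using induction_word with
      | hw u =>
        induction y using induction_word with
        | hw w =>
          induction z using induction_word with
          | hw z => exact assoc_word u w z
          | h0 => simp
          | ha y z hy hz => simp only [mul_add, hy, hz]
          | hs c y hy => simp only [mul_smul_comm, hy]
        | h0 => simp
        | ha y z hy hz => simp only [mul_add, add_mul, hy, hz]
        | hs c y hy => simp only [mul_smul_comm, smul_mul_assoc, hy]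
      | h0 => simp
      | ha x z hx hz => simp only [add_mul, hx, hz]
      | hs c x hx => simp only [smul_mul_assoc, hx] }

instance : Algebra Qv (ShuffleAlgebra n) :=
  Algebra.ofModule (fun c x y => smul_mul_assoc c x y) (fun c x y => mul_smul_comm c x y)

end ShuffleAlgebra

/-! ### The quantized enveloping algebra -/

/-- The generators of the quantized enveloping algebra; `Kinv i` is `K_i⁻¹`. -/
inductive Gen (n : ℕ) : Type
  | E (i : Vertex n)
  | F (i : Vertex n)
  | K (i : Vertex n)
  | Kinv (i : Vertex n)

/-- The defining relations of the quantized enveloping algebra of `sl_{n+1}`, for elements `e i`,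
`f i`, `k i`, `k' i` of an algebra over `ℚ(v)` in the place of `E_i`, `F_i`, `K_i`, `K_i⁻¹`. -/
structure Satisfies {A : Type*} [Ring A] [Algebra Qv A] (e f k k' : Vertex n → A) : Prop where
  kk : ∀ i j, k i * k j = k j * k i
  kk' : ∀ i, k i * k' i = 1
  k'k : ∀ i, k' i * k i = 1
  ke : ∀ i j, k i * e j * k' i = v ^ cartan i j • e j
  kf : ∀ i j, k i * f j * k' i = v ^ (-cartan i j) • f j
  ef_self : ∀ i, e i * f i - f i * e i = (v - v⁻¹)⁻¹ • (k i - k' i)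
  ef_ne : ∀ i j, i ≠ j → e i * f j - f j * e i = 0
  e_serre : ∀ i j, Adj i j → e i ^ 2 * e j - (v + v⁻¹) • (e i * e j * e i) + e j * e i ^ 2 = 0
  f_serre : ∀ i j, Adj i j → f i ^ 2 * f j - (v + v⁻¹) • (f i * f j * f i) + f j * f i ^ 2 = 0
  ee : ∀ i j, Far i j → e i * e j = e j * e i
  ff : ∀ i j, Far i j → f i * f j = f j * f i

/-- The same defining relations, as a relation on the free algebra over `ℚ(v)` with the generators
`E_i`, `F_i`, `K_i`, `K_i⁻¹`. -/
inductive Rel (n : ℕ) : FreeAlgebra Qv (Gen n) → FreeAlgebra Qv (Gen n) → Prop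
  | kk (i j : Vertex n) : Rel n
      (FreeAlgebra.ι Qv (Gen.K i) * FreeAlgebra.ι Qv (Gen.K j))
      (FreeAlgebra.ι Qv (Gen.K j) * FreeAlgebra.ι Qv (Gen.K i))
  | kk' (i : Vertex n) : Rel n
      (FreeAlgebra.ι Qv (Gen.K i) * FreeAlgebra.ι Qv (Gen.Kinv i)) 1
  | k'k (i : Vertex n) : Rel n
      (FreeAlgebra.ι Qv (Gen.Kinv i) * FreeAlgebra.ι Qv (Gen.K i)) 1
  | ke (i j : Vertex n) : Rel n
      (FreeAlgebra.ι Qv (Gen.K i) * FreeAlgebra.ι Qv (Gen.E j) * FreeAlgebra.ι Qv (Gen.Kinv i))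
      (v ^ cartan i j • FreeAlgebra.ι Qv (Gen.E j))
  | kf (i j : Vertex n) : Rel n
      (FreeAlgebra.ι Qv (Gen.K i) * FreeAlgebra.ι Qv (Gen.F j) * FreeAlgebra.ι Qv (Gen.Kinv i))
      (v ^ (-cartan i j) • FreeAlgebra.ι Qv (Gen.F j))
  | ef_self (i : Vertex n) : Rel n
      (FreeAlgebra.ι Qv (Gen.E i) * FreeAlgebra.ι Qv (Gen.F i)
        - FreeAlgebra.ι Qv (Gen.F i) * FreeAlgebra.ι Qv (Gen.E i))
      ((v - v⁻¹)⁻¹ • (FreeAlgebra.ι Qv (Gen.K i) - FreeAlgebra.ι Qv (Gen.Kinv i)))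
  | ef_ne (i j : Vertex n) (h : i ≠ j) : Rel n
      (FreeAlgebra.ι Qv (Gen.E i) * FreeAlgebra.ι Qv (Gen.F j)
        - FreeAlgebra.ι Qv (Gen.F j) * FreeAlgebra.ι Qv (Gen.E i)) 0
  | e_serre (i j : Vertex n) (h : Adj i j) : Rel n
      (FreeAlgebra.ι Qv (Gen.E i) ^ 2 * FreeAlgebra.ι Qv (Gen.E j)
        - (v + v⁻¹) • (FreeAlgebra.ι Qv (Gen.E i) * FreeAlgebra.ι Qv (Gen.E j)
          * FreeAlgebra.ι Qv (Gen.E i))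
        + FreeAlgebra.ι Qv (Gen.E j) * FreeAlgebra.ι Qv (Gen.E i) ^ 2) 0
  | f_serre (i j : Vertex n) (h : Adj i j) : Rel n
      (FreeAlgebra.ι Qv (Gen.F i) ^ 2 * FreeAlgebra.ι Qv (Gen.F j)
        - (v + v⁻¹) • (FreeAlgebra.ι Qv (Gen.F i) * FreeAlgebra.ι Qv (Gen.F j)
          * FreeAlgebra.ι Qv (Gen.F i))
        + FreeAlgebra.ι Qv (Gen.F j) * FreeAlgebra.ι Qv (Gen.F i) ^ 2) 0
  | ee (i j : Vertex n) (h : Far i j) : Rel n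
      (FreeAlgebra.ι Qv (Gen.E i) * FreeAlgebra.ι Qv (Gen.E j))
      (FreeAlgebra.ι Qv (Gen.E j) * FreeAlgebra.ι Qv (Gen.E i))
  | ff (i j : Vertex n) (h : Far i j) : Rel n
      (FreeAlgebra.ι Qv (Gen.F i) * FreeAlgebra.ι Qv (Gen.F j))
      (FreeAlgebra.ι Qv (Gen.F j) * FreeAlgebra.ι Qv (Gen.F i))

/-- The quantized enveloping algebra `U_v(g)` of `g = sl_{n+1}`: the quotient of the free algebra by
the two-sided ideal that the relations generate. -/
def QuantumGroup (n : ℕ) : Type := RingQuot (Rel n)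

namespace QuantumGroup

instance : Ring (QuantumGroup n) := inferInstanceAs (Ring (RingQuot (Rel n)))
instance : Algebra Qv (QuantumGroup n) := inferInstanceAs (Algebra Qv (RingQuot (Rel n)))

/-- The projection from the free algebra. -/
def proj (n : ℕ) : FreeAlgebra Qv (Gen n) →ₐ[Qv] QuantumGroup n := RingQuot.mkAlgHom Qv (Rel n)

/-- The generator `E_i`. -/
def E (i : Vertex n) : QuantumGroup n := proj n (FreeAlgebra.ι Qv (Gen.E i))
/-- The generator `F_i`. -/
def F (i : Vertex n) : QuantumGroup n := proj n (FreeAlgebra.ι Qv (Gen.F i))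
/-- The generator `K_i`. -/
def K (i : Vertex n) : QuantumGroup n := proj n (FreeAlgebra.ι Qv (Gen.K i))
/-- The generator `K_i⁻¹`. -/
def Kinv (i : Vertex n) : QuantumGroup n := proj n (FreeAlgebra.ι Qv (Gen.Kinv i))

lemma proj_rel {x y : FreeAlgebra Qv (Gen n)} (h : Rel n x y) : proj n x = proj n y :=
  RingQuot.mkAlgHom_rel Qv h

lemma satisfies : Satisfies (A := QuantumGroup n) E F K Kinv where
  kk i j := by simpa [K] using proj_rel (Rel.kk i j)
  kk' i := by simpa [K, Kinv] using proj_rel (Rel.kk' i)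
  k'k i := by simpa [K, Kinv] using proj_rel (Rel.k'k i)
  ke i j := by simpa [K, Kinv, E] using proj_rel (Rel.ke i j)
  kf i j := by simpa only [map_mul, map_smul, K, Kinv, F] using proj_rel (Rel.kf i j)
  ef_self i := by simpa [K, Kinv, E, F] using proj_rel (Rel.ef_self i)
  ef_ne i j h := by simpa [K, Kinv, E, F] using proj_rel (Rel.ef_ne i j h)
  e_serre i j h := by
    simpa only [map_add, map_sub, map_mul, map_pow, map_smul, map_zero, E] using
      proj_rel (Rel.e_serre i j h)
  f_serre i j h := by
    simpa only [map_add, map_sub, map_mul, map_pow, map_smul, map_zero, F] using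
      proj_rel (Rel.f_serre i j h)
  ee i j h := by simpa [E] using proj_rel (Rel.ee i j h)
  ff i j h := by simpa [F] using proj_rel (Rel.ff i j h)

section Lift
variable {A : Type*} [Ring A] [Algebra Qv A]

/-- The images of the generators. -/
def genImage (e f k k' : Vertex n → A) : Gen n → A
  | Gen.E i => e i
  | Gen.F i => f i
  | Gen.K i => k i
  | Gen.Kinv i => k' i

/-- The homomorphism with prescribed images of the generators that satisfy the relations. -/
def lift {e f k k' : Vertex n → A} (h : Satisfies e f k k') : QuantumGroup n →ₐ[Qv] A :=
  RingQuot.liftAlgHom Qv ⟨FreeAlgebra.lift Qv (genImage e f k k'), by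
    intro x y hxy
    cases hxy with
    | kk i j => simpa [genImage] using h.kk i j
    | kk' i => simpa [genImage] using h.kk' i
    | k'k i => simpa [genImage] using h.k'k i
    | ke i j => simpa [genImage] using h.ke i j
    | kf i j =>
      simpa only [map_mul, map_smul, FreeAlgebra.lift_ι_apply, genImage] using h.kf i j
    | ef_self i => simpa [genImage] using h.ef_self i
    | ef_ne i j hij => simpa [genImage] using h.ef_ne i j hij
    | e_serre i j hij =>
      simpa only [map_add, map_sub, map_mul, map_pow, map_smul, map_zero,
        FreeAlgebra.lift_ι_apply, genImage] using h.e_serre i j hij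
    | f_serre i j hij =>
      simpa only [map_add, map_sub, map_mul, map_pow, map_smul, map_zero,
        FreeAlgebra.lift_ι_apply, genImage] using h.f_serre i j hij
    | ee i j hij => simpa [genImage] using h.ee i j hij
    | ff i j hij => simpa [genImage] using h.ff i j hij⟩

variable {e f k k' : Vertex n → A} (h : Satisfies e f k k')

lemma lift_proj (x : FreeAlgebra Qv (Gen n)) :
    lift h (proj n x) = FreeAlgebra.lift Qv (genImage e f k k') x :=
  RingQuot.liftAlgHom_mkAlgHom_apply ..

@[simp] lemma lift_E (i : Vertex n) : lift h (E i) = e i := by simp [E, lift_proj, genImage]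
@[simp] lemma lift_F (i : Vertex n) : lift h (F i) = f i := by simp [F, lift_proj, genImage]
@[simp] lemma lift_K (i : Vertex n) : lift h (K i) = k i := by simp [K, lift_proj, genImage]
@[simp] lemma lift_Kinv (i : Vertex n) : lift h (Kinv i) = k' i := by
  simp [Kinv, lift_proj, genImage]

lemma hom_ext {φ ψ : QuantumGroup n →ₐ[Qv] A} (hE : ∀ i, φ (E i) = ψ (E i))
    (hF : ∀ i, φ (F i) = ψ (F i)) (hK : ∀ i, φ (K i) = ψ (K i))
    (hK' : ∀ i, φ (Kinv i) = ψ (Kinv i)) : φ = ψ := by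
  apply RingQuot.ringQuot_ext'
  apply FreeAlgebra.hom_ext
  funext g
  cases g with
  | E i => exact hE i
  | F i => exact hF i
  | K i => exact hK i
  | Kinv i => exact hK' i

end Lift

/-! ### Lusztig's automorphisms -/

section Identities
variable {R A : Type*} [Field R] [Ring A] [Algebra R A]

lemma key_left {q p : R} (hq : q ≠ 0) (hq2 : q ^ 2 + 1 ≠ 0) {e a b : A}
    (ha : e ^ 2 * a - (q + q⁻¹) • (e * a * e) + a * e ^ 2 = 0)
    (hb : e ^ 2 * b - (q + q⁻¹) • (e * b * e) + b * e ^ 2 = 0)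
    (hab : a * b = p • (b * a)) :
    (a * e - q • (e * a)) * (b * e - q • (e * b)) =
      p • ((b * e - q • (e * b)) * (a * e - q • (e * a))) := by
  linear_combination (norm := skip) (-(q / (q ^ 2 + 1))) • (a * hb)
    + (p * (q / (q ^ 2 + 1))) • (b * ha) - (q ^ 2 * (q / (q ^ 2 + 1))) • (ha * b)
    + (p * q ^ 2 * (q / (q ^ 2 + 1))) • (hb * a) - q • (e * hab * e)
    + (q / (q ^ 2 + 1)) • (hab * e * e) + (q ^ 2 * (q / (q ^ 2 + 1))) • (e * e * hab)
  simp only [pow_two e, mul_add, add_mul, mul_sub, sub_mul, neg_mul, smul_mul_assoc,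
    mul_smul_comm, smul_add, smul_sub, smul_smul, mul_assoc, mul_zero, zero_mul]
  match_scalars <;> field_simp <;> ring

lemma key_right {q p : R} (hq : q ≠ 0) (hq2 : q ^ 2 + 1 ≠ 0) {e a b : A}
    (ha : e ^ 2 * a - (q + q⁻¹) • (e * a * e) + a * e ^ 2 = 0)
    (hb : e ^ 2 * b - (q + q⁻¹) • (e * b * e) + b * e ^ 2 = 0)
    (hab : a * b = p • (b * a)) :
    (e * a - q • (a * e)) * (e * b - q • (b * e)) =
      p • ((e * b - q • (b * e)) * (e * a - q • (a * e))) := by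
  linear_combination (norm := skip) (-(q ^ 2 * (q / (q ^ 2 + 1)))) • (a * hb)
    + (p * (q ^ 2 * (q / (q ^ 2 + 1)))) • (b * ha) - (q / (q ^ 2 + 1)) • (ha * b)
    + (p * (q / (q ^ 2 + 1))) • (hb * a) - q • (e * hab * e)
    + (q ^ 2 * (q / (q ^ 2 + 1))) • (hab * e * e) + (q / (q ^ 2 + 1)) • (e * e * hab)
  simp only [pow_two e, mul_add, add_mul, mul_sub, sub_mul, neg_mul, smul_mul_assoc,
    mul_smul_comm, smul_add, smul_sub, smul_smul, mul_assoc, mul_zero, zero_mul]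
  match_scalars <;> field_simp <;> ring

lemma serre_far_left {q : R} (hq : q ≠ 0) (hq2 : q ^ 2 + 1 ≠ 0) {e a c : A}
    (hea : e ^ 2 * a - (q + q⁻¹) • (e * a * e) + a * e ^ 2 = 0)
    (hac : a ^ 2 * c - (q + q⁻¹) • (a * c * a) + c * a ^ 2 = 0) (hec : e * c = c * e) :
    (a * e - q • (e * a)) ^ 2 * c - (q + q⁻¹) • ((a * e - q • (e * a)) * c *
      (a * e - q • (e * a))) + c * (a * e - q • (e * a)) ^ 2 = 0 := by
  have hb : e ^ 2 * (a * c - q⁻¹ • (c * a)) - (q + q⁻¹) • (e * (a * c - q⁻¹ • (c * a)) * e)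
      + (a * c - q⁻¹ • (c * a)) * e ^ 2 = 0 := by
    linear_combination (norm := skip) hea * c - q⁻¹ • (c * hea) - q⁻¹ • (e * hec * a)
      - q⁻¹ • (hec * e * a) + (q⁻¹ * (q + q⁻¹)) • (hec * a * e) + (q + q⁻¹) • (e * a * hec)
      - a * e * hec - a * hec * e
    simp only [pow_two e, mul_add, add_mul, mul_sub, sub_mul, neg_mul, smul_mul_assoc,
      mul_smul_comm, smul_add, smul_sub, smul_smul, mul_assoc, mul_zero, zero_mul]
    match_scalars <;> field_simp <;> ring
  have hab : a * (a * c - q⁻¹ • (c * a)) = q • ((a * c - q⁻¹ • (c * a)) * a) := by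
    linear_combination (norm := skip) hac
    simp only [pow_two a, mul_sub, sub_mul, smul_mul_assoc,
      mul_smul_comm, smul_sub, smul_smul, mul_assoc]
    match_scalars <;> field_simp <;> ring
  have h := key_left hq hq2 hea hb hab
  have hW : (a * c - q⁻¹ • (c * a)) * e - q • (e * (a * c - q⁻¹ • (c * a))) =
      (a * e - q • (e * a)) * c - q⁻¹ • (c * (a * e - q • (e * a))) := by
    linear_combination (norm := skip) -(a * hec) + hec * a
    simp only [mul_sub, sub_mul, smul_mul_assoc,
      mul_smul_comm, smul_sub, smul_smul, mul_assoc]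
    match_scalars <;> field_simp <;> ring
  rw [hW] at h
  generalize a * e - q • (e * a) = y at h ⊢
  linear_combination (norm := skip) h
  simp only [pow_two y, mul_sub, sub_mul, smul_mul_assoc,
    mul_smul_comm, smul_sub, smul_smul, mul_assoc]
  match_scalars <;> field_simp <;> ring

lemma serre_far_right {q : R} (hq : q ≠ 0) (hq2 : q ^ 2 + 1 ≠ 0) {e a c : A}
    (hea : e ^ 2 * a - (q + q⁻¹) • (e * a * e) + a * e ^ 2 = 0)
    (hac : a ^ 2 * c - (q + q⁻¹) • (a * c * a) + c * a ^ 2 = 0) (hec : e * c = c * e) :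
    (e * a - q • (a * e)) ^ 2 * c - (q + q⁻¹) • ((e * a - q • (a * e)) * c *
      (e * a - q • (a * e))) + c * (e * a - q • (a * e)) ^ 2 = 0 := by
  have hb : e ^ 2 * (a * c - q⁻¹ • (c * a)) - (q + q⁻¹) • (e * (a * c - q⁻¹ • (c * a)) * e)
      + (a * c - q⁻¹ • (c * a)) * e ^ 2 = 0 := by
    linear_combination (norm := skip) hea * c - q⁻¹ • (c * hea) - q⁻¹ • (e * hec * a)
      - q⁻¹ • (hec * e * a) + (q⁻¹ * (q + q⁻¹)) • (hec * a * e) + (q + q⁻¹) • (e * a * hec)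
      - a * e * hec - a * hec * e
    simp only [pow_two e, mul_add, add_mul, mul_sub, sub_mul, neg_mul, smul_mul_assoc,
      mul_smul_comm, smul_add, smul_sub, smul_smul, mul_assoc, mul_zero, zero_mul]
    match_scalars <;> field_simp <;> ring
  have hab : a * (a * c - q⁻¹ • (c * a)) = q • ((a * c - q⁻¹ • (c * a)) * a) := by
    linear_combination (norm := skip) hac
    simp only [pow_two a, mul_sub, sub_mul, smul_mul_assoc,
      mul_smul_comm, smul_sub, smul_smul, mul_assoc]
    match_scalars <;> field_simp <;> ring
  have h := key_right hq hq2 hea hb hab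
  have hW : e * (a * c - q⁻¹ • (c * a)) - q • ((a * c - q⁻¹ • (c * a)) * e) =
      (e * a - q • (a * e)) * c - q⁻¹ • (c * (e * a - q • (a * e))) := by
    linear_combination (norm := skip) q • (a * hec) - q⁻¹ • (hec * a)
    simp only [mul_sub, sub_mul, smul_mul_assoc,
      mul_smul_comm, smul_sub, smul_smul, mul_assoc]
    match_scalars <;> field_simp <;> ring
  rw [hW] at h
  generalize e * a - q • (a * e) = y at h ⊢
  linear_combination (norm := skip) h
  simp only [pow_two y, mul_sub, sub_mul, smul_mul_assoc,
    mul_smul_comm, smul_sub, smul_smul, mul_assoc]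
  match_scalars <;> field_simp <;> ring

lemma serre_of_first {q : R} (hq : q ≠ 0) {x y z : A} (h : x * y - q • (y * x) = z)
    (hz : x * z = q⁻¹ • (z * x)) :
    x ^ 2 * y - (q + q⁻¹) • (x * y * x) + y * x ^ 2 = 0 := by
  subst h
  linear_combination (norm := skip) hz
  simp only [pow_two x, mul_sub, sub_mul, smul_mul_assoc,
    mul_smul_comm, smul_sub, smul_smul, mul_assoc]
  match_scalars <;> field_simp <;> ring

lemma serre_of_second {q : R} (hq : q ≠ 0) {x y z : A} (h : x * y - q • (y * x) = z)
    (hz : z * y = q⁻¹ • (y * z)) :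
    y ^ 2 * x - (q + q⁻¹) • (y * x * y) + x * y ^ 2 = 0 := by
  subst h
  linear_combination (norm := skip) hz
  simp only [pow_two y, mul_sub, sub_mul, smul_mul_assoc,
    mul_smul_comm, smul_sub, smul_smul, mul_assoc]
  match_scalars <;> field_simp <;> ring

end Identities

section Conj

/-- The element `K_i` as a unit. -/
def Ku (i : Vertex n) : (QuantumGroup n)ˣ := ⟨K i, Kinv i, satisfies.kk' i, satisfies.k'k i⟩

@[simp] lemma val_Ku (i : Vertex n) : (Ku i : QuantumGroup n) = K i := rfl
@[simp] lemma val_inv_Ku (i : Vertex n) : ((Ku i)⁻¹ : (QuantumGroup n)ˣ) = Kinv i := rfl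

lemma Ku_comm (i j : Vertex n) : Ku i * Ku j = Ku j * Ku i := Units.ext (satisfies.kk i j)

/-- Conjugation by the unit `u` multiplies `x` by `v ^ m`. -/
def Wt (u : (QuantumGroup n)ˣ) (m : ℤ) (x : QuantumGroup n) : Prop := ↑u * x = v ^ m • (x * ↑u)

variable {u w : (QuantumGroup n)ˣ} {m l : ℤ} {x y : QuantumGroup n}

lemma Wt.mul_unit (h : Wt u m x) (h' : Wt w l x) : Wt (u * w) (m + l) x := by
  unfold Wt at *
  rw [Units.val_mul, mul_assoc, h', mul_smul_comm, ← mul_assoc, h, smul_mul_assoc, smul_smul,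
    mul_assoc, ← zpow_add₀ v_ne_zero, add_comm]

lemma Wt.one : Wt 1 0 x := by simp [Wt]

lemma Wt.inv (h : Wt u m x) : Wt u⁻¹ (-m) x := by
  unfold Wt at *
  have h2 : x * (↑u⁻¹ : QuantumGroup n) = v ^ m • (↑u⁻¹ * x) := by
    calc x * (↑u⁻¹ : QuantumGroup n) = ↑u⁻¹ * (↑u * x) * ↑u⁻¹ := by simp [← mul_assoc]
      _ = v ^ m • (↑u⁻¹ * x) := by rw [h]; simp [mul_smul_comm, smul_mul_assoc, mul_assoc]
  rw [h2, smul_smul, ← zpow_add₀ v_ne_zero]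
  simp

lemma Wt.pow (h : Wt u m x) (r : ℕ) : Wt (u ^ r) (r * m) x := by
  induction r with
  | zero => simpa using Wt.one
  | succ r ih =>
    rw [pow_succ]
    have := ih.mul_unit h
    convert this using 1
    push_cast; ring

lemma Wt.zpow (h : Wt u m x) (r : ℤ) : Wt (u ^ r) (r * m) x := by
  obtain ⟨r, rfl | rfl⟩ := r.eq_nat_or_neg
  · simpa using h.pow r
  · simpa using (h.pow r).inv

lemma Wt.mul (h : Wt u m x) (h' : Wt u l y) : Wt u (m + l) (x * y) := by
  unfold Wt at *
  rw [← mul_assoc, h, smul_mul_assoc, mul_assoc, h', mul_smul_comm, smul_smul, mul_assoc,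
    ← zpow_add₀ v_ne_zero]

lemma Wt.sub (h : Wt u m x) (h' : Wt u m y) : Wt u m (x - y) := by
  unfold Wt at *
  rw [mul_sub, h, h', sub_mul, smul_sub]

lemma Wt.neg (h : Wt u m x) : Wt u m (-x) := by
  unfold Wt at *
  rw [mul_neg, h, neg_mul, smul_neg]

lemma Wt.smul (h : Wt u m x) (c : Qv) : Wt u m (c • x) := by
  unfold Wt at *
  rw [mul_smul_comm, h, smul_mul_assoc, smul_comm]

lemma Wt.conj (h : Wt u m x) : ↑u * x * (↑u⁻¹ : QuantumGroup n) = v ^ m • x := by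
  unfold Wt at h
  rw [h, smul_mul_assoc, mul_assoc, Units.mul_inv, mul_one]

lemma wt_of_conj (h : ↑u * x * (↑u⁻¹ : QuantumGroup n) = v ^ m • x) : Wt u m x := by
  unfold Wt
  rw [← smul_mul_assoc, ← h, mul_assoc, Units.inv_mul, mul_one]

lemma wt_E (i j : Vertex n) : Wt (Ku i) (cartan i j) (E j) := wt_of_conj (satisfies.ke i j)
lemma wt_F (i j : Vertex n) : Wt (Ku i) (-cartan i j) (F j) := wt_of_conj (satisfies.kf i j)

lemma wt_K (i j : Vertex n) : Wt (Ku i) 0 (K j) := by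
  simpa [Wt] using satisfies.kk i j

lemma wt_Kinv (i j : Vertex n) : Wt (Ku i) 0 (Kinv j) := by
  have : Wt (Ku j) 0 (K i) := wt_K j i
  have := this.inv
  simp only [Wt, val_inv_Ku, val_Ku, neg_zero, zpow_zero, one_smul] at this ⊢
  exact this.symm

end Conj

section T
open Classical

/-- The values `T_i(E_j)`. -/
def TE (i j : Vertex n) : QuantumGroup n :=
  if i = j then -(Kinv i * F i)
  else if Adj i j then E j * E i - v⁻¹ • (E i * E j)
  else E j

/-- The values `T_i(F_j)`. -/
def TF (i j : Vertex n) : QuantumGroup n :=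
  if i = j then -(E i * K i)
  else if Adj i j then F i * F j - v • (F j * F i)
  else F j

/-- The values `T_i(K_j) = K_j K_i ^ (-a_ij)`. -/
def TK (i j : Vertex n) : (QuantumGroup n)ˣ := Ku j * Ku i ^ (-cartan i j)

lemma TE_self (i : Vertex n) : TE i i = -(Kinv i * F i) := by simp [TE]
lemma TF_self (i : Vertex n) : TF i i = -(E i * K i) := by simp [TF]
lemma TE_adj {i j : Vertex n} (h : Adj i j) : TE i j = E j * E i - v⁻¹ • (E i * E j) := by
  simp [TE, h, h.ne]
lemma TF_adj {i j : Vertex n} (h : Adj i j) : TF i j = F i * F j - v • (F j * F i) := by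
  simp [TF, h, h.ne]
lemma TE_far {i j : Vertex n} (h : Far i j) : TE i j = E j := by simp [TE, h.ne, h.not_adj]
lemma TF_far {i j : Vertex n} (h : Far i j) : TF i j = F j := by simp [TF, h.ne, h.not_adj]

lemma TK_self (i : Vertex n) : TK i i = (Ku i)⁻¹ := by
  simp only [TK, cartan_self]
  group

lemma TK_adj {i j : Vertex n} (h : Adj i j) : TK i j = Ku j * Ku i := by
  simp [TK, cartan_adj h]

lemma TK_far {i j : Vertex n} (h : Far i j) : TK i j = Ku j := by
  simp [TK, cartan_far h]

lemma cases3 (i j : Vertex n) : i = j ∨ Adj i j ∨ Far i j := by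
  by_cases h1 : i = j
  · exact Or.inl h1
  · by_cases h2 : Adj i j
    · exact Or.inr (Or.inl h2)
    · exact Or.inr (Or.inr (far_of h1 h2))

lemma wt_TE (i p q : Vertex n) :
    Wt (Ku p) (cartan p q - cartan i q * cartan p i) (TE i q) := by
  rcases cases3 i q with rfl | h | h
  · rw [TE_self, cartan_self]
    have := ((wt_Kinv p i).mul (wt_F p i)).neg
    convert this using 1; ring
  · rw [TE_adj h, cartan_adj h]
    have h1 := (wt_E p q).mul (wt_E p i)
    have h2 := (wt_E p i).mul (wt_E p q)
    rw [add_comm] at h2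
    have := h1.sub (h2.smul v⁻¹)
    convert this using 1; ring
  · rw [TE_far h, cartan_far h]
    convert wt_E p q using 1; ring

lemma wt_TF (i p q : Vertex n) :
    Wt (Ku p) (-(cartan p q - cartan i q * cartan p i)) (TF i q) := by
  rcases cases3 i q with rfl | h | h
  · rw [TF_self, cartan_self]
    have := ((wt_E p i).mul (wt_K p i)).neg
    convert this using 1; ring
  · rw [TF_adj h, cartan_adj h]
    have h1 := (wt_F p q).mul (wt_F p i)
    have h2 := (wt_F p i).mul (wt_F p q)
    rw [add_comm] at h1
    have := h2.sub (h1.smul v)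
    convert this using 1; ring
  · rw [TF_far h, cartan_far h]
    convert wt_F p q using 1; ring

lemma wt_TK_TE (i p q : Vertex n) : Wt (TK i p) (cartan p q) (TE i q) := by
  have := (wt_TE i p q).mul_unit ((wt_TE i i q).zpow (-cartan i p))
  unfold TK
  convert this using 1
  rw [cartan_self, cartan_comm p i]; ring

lemma wt_TK_TF (i p q : Vertex n) : Wt (TK i p) (-cartan p q) (TF i q) := by
  have := (wt_TF i p q).mul_unit ((wt_TF i i q).zpow (-cartan i p))
  unfold TK
  convert this using 1
  rw [cartan_self, cartan_comm p i]; ring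

lemma wt_Kinv_left {i : Vertex n} {m : ℤ} {x : QuantumGroup n} (h : Wt (Ku i) m x) :
    Kinv i * x = v ^ (-m) • (x * Kinv i) := h.inv

/-- `T_i(E_j) F_i - F_i T_i(E_j)` for neighbours. -/
lemma TE_F {i j : Vertex n} (h : Adj i j) :
    TE i j * F i - F i * TE i j = v⁻¹ • (E j * K i) := by
  have h0 := v_ne_zero
  have h1 := v_sq_ne'
  have e1 := satisfies.ef_self i
  have e2 := satisfies.ef_ne j i h.ne.symm
  have e3 : K i * E j = v ^ (-1 : ℤ) • (E j * K i) := by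
    simpa [Wt, cartan_adj h] using wt_E i j
  have e4 : Kinv i * E j = v ^ (1 : ℤ) • (E j * Kinv i) := by
    simpa [cartan_adj h] using wt_Kinv_left (wt_E i j)
  rw [TE_adj h]
  linear_combination (norm := skip) E j * e1 - v⁻¹ • (e1 * E j) + e2 * E i - v⁻¹ • (E i * e2)
    - (v⁻¹ * (v - v⁻¹)⁻¹) • e3 + (v⁻¹ * (v - v⁻¹)⁻¹) • e4
  simp only [mul_add, add_mul, mul_sub, sub_mul, smul_mul_assoc, zpow_neg, zpow_one,
    mul_smul_comm, smul_add, smul_sub, smul_smul, mul_assoc, mul_zero, zero_mul]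
  have hc : (v - v⁻¹)⁻¹ = v / (v ^ 2 - 1) := by
    have := v_sub_ne
    field_simp
  rw [hc]
  match_scalars <;> field_simp <;> ring

/-- `T_i(E_j) F_j - F_j T_i(E_j)` for neighbours. -/
lemma TE_F' {i j : Vertex n} (h : Adj i j) :
    TE i j * F j - F j * TE i j = -(E i * Kinv j) := by
  have h0 := v_ne_zero
  have h1 := v_sq_ne'
  have e1 := satisfies.ef_self j
  have e2 := satisfies.ef_ne i j h.ne
  have e3 : K j * E i = v ^ (-1 : ℤ) • (E i * K j) := by
    simpa [Wt, cartan_adj (adj_comm.1 h)] using wt_E j i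
  have e4 : Kinv j * E i = v ^ (1 : ℤ) • (E i * Kinv j) := by
    simpa [cartan_adj (adj_comm.1 h)] using wt_Kinv_left (wt_E j i)
  rw [TE_adj h]
  linear_combination (norm := skip) e1 * E i - v⁻¹ • (E i * e1) + E j * e2 - v⁻¹ • (e2 * E j)
    + ((v - v⁻¹)⁻¹) • e3 - ((v - v⁻¹)⁻¹) • e4
  simp only [mul_add, add_mul, mul_sub, sub_mul, smul_mul_assoc, zpow_neg, zpow_one,
    mul_smul_comm, smul_add, smul_sub, smul_smul, mul_assoc, mul_zero, zero_mul]
  have hc : (v - v⁻¹)⁻¹ = v / (v ^ 2 - 1) := by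
    have := v_sub_ne
    field_simp
  rw [hc]
  match_scalars <;> field_simp <;> ring

/-- `E_i T_i(F_j) - T_i(F_j) E_i` for neighbours. -/
lemma E_TF {i j : Vertex n} (h : Adj i j) :
    E i * TF i j - TF i j * E i = F j * Kinv i := by
  have h0 := v_ne_zero
  have h1 := v_sq_ne'
  have e1 := satisfies.ef_self i
  have e2 := satisfies.ef_ne i j h.ne
  have e3 : K i * F j = v ^ (1 : ℤ) • (F j * K i) := by
    simpa [Wt, cartan_adj h] using wt_F i j
  have e4 : Kinv i * F j = v ^ (-1 : ℤ) • (F j * Kinv i) := by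
    simpa [cartan_adj h] using wt_Kinv_left (wt_F i j)
  rw [TF_adj h]
  linear_combination (norm := skip) e1 * F j - v • (F j * e1) + F i * e2 - v • (e2 * F i)
    + ((v - v⁻¹)⁻¹) • e3 - ((v - v⁻¹)⁻¹) • e4
  simp only [mul_add, add_mul, mul_sub, sub_mul, smul_mul_assoc, zpow_neg, zpow_one,
    mul_smul_comm, smul_add, smul_sub, smul_smul, mul_assoc, mul_zero, zero_mul]
  have hc : (v - v⁻¹)⁻¹ = v / (v ^ 2 - 1) := by
    have := v_sub_ne
    field_simp
  rw [hc]
  match_scalars <;> field_simp <;> ring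

/-- `T_i(E_i E_j - v⁻¹ E_j E_i) = E_j` for neighbours. -/
lemma TE_TE {i j : Vertex n} (h : Adj i j) :
    TE i i * TE i j - v⁻¹ • (TE i j * TE i i) = E j := by
  have h0 := v_ne_zero
  have h1 := TE_F h
  have e1 : Kinv i * TE i j = v ^ (-1 : ℤ) • (TE i j * Kinv i) := by
    simpa [cartan_adj h] using wt_Kinv_left (wt_TE i i j)
  have e4 : Kinv i * E j = v ^ (1 : ℤ) • (E j * Kinv i) := by
    simpa [cartan_adj h] using wt_Kinv_left (wt_E i j)
  have e5 := satisfies.k'k i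
  rw [TE_self]
  linear_combination (norm := skip) Kinv i * h1 - e1 * F i + v⁻¹ • (e4 * K i) + E j * e5
  simp only [mul_sub, sub_mul, smul_mul_assoc, zpow_neg, zpow_one, neg_mul, mul_neg,
    mul_smul_comm, smul_sub, smul_neg, smul_smul, mul_assoc, mul_one]
  match_scalars <;> field_simp <;> ring

/-- `T_i(F_j F_i - v F_i F_j) = F_j` for neighbours. -/
lemma TF_TF {i j : Vertex n} (h : Adj i j) :
    TF i j * TF i i - v • (TF i i * TF i j) = F j := by
  have h0 := v_ne_zero
  have h1 := E_TF h
  have e1 : K i * TF i j = v ^ (-1 : ℤ) • (TF i j * K i) := by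
    simpa [Wt, cartan_adj h] using wt_TF i i j
  have e5 := satisfies.k'k i
  rw [TF_self]
  linear_combination (norm := skip) h1 * K i + v • (E i * e1) + F j * e5
  simp only [mul_sub, sub_mul, smul_mul_assoc, zpow_neg, zpow_one, neg_mul, mul_neg,
    mul_smul_comm, smul_sub, smul_neg, smul_smul, mul_assoc, mul_one]
  match_scalars <;> field_simp <;> ring

end T

section TRelations

lemma Kinv_E {i j : Vertex n} : Kinv i * E j = v ^ (-cartan i j) • (E j * Kinv i) :=
  wt_Kinv_left (wt_E i j)

lemma Kinv_F {i j : Vertex n} : Kinv i * F j = v ^ (cartan i j) • (F j * Kinv i) := by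
  simpa using wt_Kinv_left (wt_F i j)

lemma two_eq : v⁻¹ + v⁻¹⁻¹ = v + v⁻¹ := by rw [inv_inv, add_comm]

lemma v_inv_sq_ne : v⁻¹ ^ 2 + 1 ≠ 0 := by
  have h0 := v_ne_zero
  have h1 := v_sq_ne
  intro h
  apply h1
  field_simp at h
  linear_combination h

lemma T_ef_self (i p : Vertex n) :
    TE i p * TF i p - TF i p * TE i p
      = (v - v⁻¹)⁻¹ • ((TK i p : QuantumGroup n) - ((TK i p)⁻¹ : (QuantumGroup n)ˣ)) := by
  have h0 := v_ne_zero
  rcases cases3 i p with rfl | h | h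
  · rw [TK_self, TE_self, TF_self, inv_inv, val_Ku, val_inv_Ku]
    have e1 := satisfies.ef_self i
    have e2 : Kinv i * (F i * E i) = F i * E i * Kinv i := by
      have := wt_Kinv_left ((wt_F i i).mul (wt_E i i))
      simpa using this
    have e3 := satisfies.k'k i
    have e4 := satisfies.kk' i
    linear_combination (norm := skip) -e1 + e2 * K i + F i * E i * e3 - E i * e4 * F i
    simp only [mul_sub, sub_mul, smul_mul_assoc, neg_mul, mul_neg, neg_neg,
      mul_smul_comm, smul_sub, smul_neg, smul_smul, mul_assoc, mul_one, one_mul]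
    match_scalars <;> ring
  · have hK : ((TK i p)⁻¹ : (QuantumGroup n)ˣ) = (Ku p)⁻¹ * (Ku i)⁻¹ := by
      rw [TK_adj h, Ku_comm, mul_inv_rev]
    rw [hK, TK_adj h, Units.val_mul, Units.val_mul, val_Ku, val_Ku, val_inv_Ku, val_inv_Ku]
    have e1 := TE_F h
    have e2 := TE_F' h
    have e3 : K i * F p = v ^ (1 : ℤ) • (F p * K i) := by
      simpa [Wt, cartan_adj h] using wt_F i p
    have e4 : Kinv p * F i = v ^ (-1 : ℤ) • (F i * Kinv p) := by
      simpa [cartan_adj (adj_comm.1 h)] using Kinv_F (i := p) (j := i)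
    have e5 := satisfies.ef_self i
    have e6 := satisfies.ef_self p
    have e7 : Kinv i * Kinv p = Kinv p * Kinv i :=
      congrArg Units.val (((show Commute (Ku i) (Ku p) from Ku_comm i p).inv_left).inv_right).eq
    have e8 : K i * Kinv p = Kinv p * K i :=
      congrArg Units.val ((show Commute (Ku i) (Ku p) from Ku_comm i p).inv_right).eq
    rw [TF_adj h]
    generalize TE i p = y at *
    linear_combination (norm := skip) e1 * F p + F i * e2 - v • (e2 * F i) - v • (F p * e1)
      + v⁻¹ • (E p * e3) + v • (E i * e4) + e6 * K i + e5 * Kinv p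
      + (v - v⁻¹)⁻¹ • e8 - (v - v⁻¹)⁻¹ • e7
    generalize (v - v⁻¹)⁻¹ = c
    simp only [mul_sub, sub_mul, smul_mul_assoc, zpow_one, zpow_neg, neg_mul, mul_neg, smul_neg,
          mul_smul_comm, smul_sub, smul_smul, mul_assoc]
    match_scalars <;> field_simp <;> ring
  · rw [TK_far h, TE_far h, TF_far h]
    exact satisfies.ef_self p

lemma T_ef_ne (i p q : Vertex n) (hpq : p ≠ q) :
    TE i p * TF i q - TF i q * TE i p = 0 := by
  have h0 := v_ne_zero
  rcases cases3 i p with rfl | h | h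
  · rcases cases3 i q with rfl | h' | h'
    · exact absurd rfl hpq
    · -- the relation follows from the Serre relation
      have e1 := satisfies.f_serre i q h'
      have e2 : Kinv i * F q = v ^ (-1 : ℤ) • (F q * Kinv i) := by
        simpa [cartan_adj h'] using Kinv_F (i := i) (j := q)
      have e3 : Kinv i * F i = v ^ (2 : ℤ) • (F i * Kinv i) := by
        simpa using Kinv_F (i := i) (j := i)
      have e4 : Kinv i * TF i q = v ^ (1 : ℤ) • (TF i q * Kinv i) := by
        have := wt_Kinv_left (wt_TF i i q)
        rw [cartan_self, cartan_adj h'] at this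
        convert this using 3
        norm_num
      have e5 : TF i q * Kinv i = v⁻¹ • (Kinv i * TF i q) := by
        rw [e4, smul_smul, zpow_one, inv_mul_cancel₀ h0, one_smul]
      rw [TE_self]
      have e6 : F i * TF i q - v⁻¹ • (TF i q * F i) = 0 := by
        rw [TF_adj h']
        linear_combination (norm := skip) e1
        simp only [pow_two, mul_sub, sub_mul, smul_mul_assoc, add_smul,
          mul_smul_comm, smul_sub, smul_smul, mul_assoc]
        match_scalars <;> field_simp <;> ring
      linear_combination (norm := skip) -(Kinv i * e6) + e5 * F i
      simp only [mul_sub, sub_mul, smul_mul_assoc, neg_mul, mul_neg,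
        mul_smul_comm, smul_sub, smul_smul, mul_assoc, mul_zero]
      match_scalars <;> ring
    · rw [TE_self, TF_far h']
      have e1 := satisfies.ff i q h'
      have e2 : Kinv i * F q = F q * Kinv i := by
        simpa [cartan_far h'] using Kinv_F (i := i) (j := q)
      linear_combination (norm := skip) -(Kinv i * e1) - e2 * F i
      noncomm_ring
  · rcases cases3 i q with rfl | h' | h'
    · have e1 := satisfies.e_serre i p h
      have e4 : K i * TE i p = v ^ (1 : ℤ) • (TE i p * K i) := by
        have := wt_TE i i p
        rw [cartan_self, cartan_adj h] at this
        simpa [Wt] using this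
      rw [TF_self]
      have e6 : E i * TE i p - v⁻¹ • (TE i p * E i) = 0 := by
        rw [TE_adj h]
        linear_combination (norm := skip) -(v⁻¹) • e1
        simp only [pow_two, mul_sub, sub_mul, smul_mul_assoc, add_smul, mul_add, smul_add,
          mul_smul_comm, smul_sub, smul_smul, mul_assoc, smul_zero]
        match_scalars <;> field_simp <;> ring
      linear_combination (norm := skip) v • (e6 * K i) + E i * e4
      simp only [mul_sub, sub_mul, smul_mul_assoc, neg_mul, mul_neg, zpow_one,
        mul_smul_comm, smul_sub, smul_smul, mul_assoc, zero_mul]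
      match_scalars <;> field_simp <;> ring
    · have e1 := TE_F h
      have hf := far_of_adj_adj h h' hpq
      have e2 := satisfies.ef_ne p q hpq
      have e3 := satisfies.ef_ne i q h'.ne
      have e4 : K i * F q = v ^ (1 : ℤ) • (F q * K i) := by
        simpa [Wt, cartan_adj h'] using wt_F i q
      have e5 : TE i p * F q - F q * TE i p = 0 := by
        rw [TE_adj h]
        linear_combination (norm := skip) e2 * E i + E p * e3 - v⁻¹ • (E i * e2 + e3 * E p)
        simp only [mul_sub, sub_mul, smul_mul_assoc, smul_add,
          mul_smul_comm, smul_sub, smul_smul, mul_assoc, zero_mul, mul_zero]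
        match_scalars <;> ring
      rw [TF_adj h']
      generalize TE i p = y at *
      linear_combination (norm := skip) e1 * F q + F i * e5 - v • (e5 * F i) - v • (F q * e1)
        + v⁻¹ • (E p * e4) + e2 * K i
      simp only [mul_sub, sub_mul, smul_mul_assoc, smul_add, zpow_one,
          mul_smul_comm, smul_sub, smul_smul, mul_assoc, zero_mul, mul_zero]
      match_scalars <;> field_simp <;> ring
    · rw [TE_adj h, TF_far h']
      have e2 := satisfies.ef_ne p q hpq
      have e3 := satisfies.ef_ne i q h'.ne
      linear_combination (norm := skip) e2 * E i + E p * e3 - v⁻¹ • (E i * e2 + e3 * E p)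
      simp only [mul_sub, sub_mul, smul_mul_assoc, smul_add,
          mul_smul_comm, smul_sub, smul_smul, mul_assoc, zero_mul, mul_zero]
      match_scalars <;> ring
  · rcases cases3 i q with rfl | h' | h'
    · rw [TE_far h, TF_self]
      have e1 := satisfies.ee i p h
      have e2 : K i * E p = E p * K i := by
        simpa [Wt, cartan_far h] using wt_E i p
      linear_combination (norm := skip) E i * e2 + e1 * K i
      noncomm_ring
    · rw [TE_far h, TF_adj h']
      have e2 := satisfies.ef_ne p q hpq
      have e3 := satisfies.ef_ne p i h.ne.symm
      linear_combination (norm := skip) e3 * F q + F i * e2 - v • (F q * e3 + e2 * F i)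
      simp only [mul_sub, sub_mul, smul_mul_assoc, smul_add,
          mul_smul_comm, smul_sub, smul_smul, mul_assoc, zero_mul, mul_zero]
      match_scalars <;> ring
    · rw [TE_far h, TF_far h']
      exact satisfies.ef_ne p q hpq

lemma T_ee (i p q : Vertex n) (hpq : Far p q) : TE i p * TE i q = TE i q * TE i p := by
  have key : ∀ p q : Vertex n, Far p q → Far i q → TE i p * TE i q = TE i q * TE i p := by
    intro p q hpq hq
    have e1 := satisfies.ee i q hq
    have e2 := satisfies.ee p q hpq
    rw [TE_far hq]
    rcases cases3 i p with rfl | h | h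
    · rw [TE_self]
      have e3 : Kinv i * E q = E q * Kinv i := by
        simpa [cartan_far hq] using Kinv_E (i := i) (j := q)
      have e4 := satisfies.ef_ne q i hq.ne.symm
      linear_combination (norm := skip) Kinv i * e4 - e3 * F i
      noncomm_ring
    · rw [TE_adj h]
      linear_combination (norm := skip) e2 * E i + E p * e1 - v⁻¹ • (E i * e2 + e1 * E p)
      simp only [mul_sub, sub_mul, smul_mul_assoc, smul_add,
          mul_smul_comm, smul_sub, smul_smul, mul_assoc, zero_mul, mul_zero]
      match_scalars <;> ring
    · rw [TE_far h, e2]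
  rcases cases3 i q with rfl | h' | h'
  · exact (key i p (far_comm.1 hpq) (far_comm.1 hpq)).symm
  · rcases cases3 i p with rfl | h | h
    · exact absurd h' hpq.not_adj
    · rw [TE_adj h, TE_adj h']
      have := key_left (p := 1) (inv_ne_zero v_ne_zero) v_inv_sq_ne
        (by rw [two_eq]; exact satisfies.e_serre i p h)
        (by rw [two_eq]; exact satisfies.e_serre i q h')
        (by rw [one_smul]; exact satisfies.ee p q hpq)
      rwa [one_smul] at this
    · exact (key q p (far_comm.1 hpq) h).symm
  · exact key p q hpq h'

lemma T_ff (i p q : Vertex n) (hpq : Far p q) : TF i p * TF i q = TF i q * TF i p := by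
  have key : ∀ p q : Vertex n, Far p q → Far i q → TF i p * TF i q = TF i q * TF i p := by
    intro p q hpq hq
    have e1 := satisfies.ff i q hq
    have e2 := satisfies.ff p q hpq
    rw [TF_far hq]
    rcases cases3 i p with rfl | h | h
    · rw [TF_self]
      have e3 : K i * F q = F q * K i := by
        simpa [Wt, cartan_far hq] using wt_F i q
      have e4 := satisfies.ef_ne i q hq.ne
      linear_combination (norm := skip) -(E i * e3) - e4 * K i
      noncomm_ring
    · rw [TF_adj h]
      linear_combination (norm := skip) F i * e2 + e1 * F p - v • (e2 * F i + F p * e1)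
      simp only [mul_sub, sub_mul, smul_mul_assoc, smul_add,
          mul_smul_comm, smul_sub, smul_smul, mul_assoc, zero_mul, mul_zero]
      match_scalars <;> ring
    · rw [TF_far h, e2]
  rcases cases3 i q with rfl | h' | h'
  · exact (key i p (far_comm.1 hpq) (far_comm.1 hpq)).symm
  · rcases cases3 i p with rfl | h | h
    · exact absurd h' hpq.not_adj
    · rw [TF_adj h, TF_adj h']
      have := key_right (p := 1) v_ne_zero v_sq_ne
        (satisfies.f_serre i p h) (satisfies.f_serre i q h')
        (by rw [one_smul]; exact satisfies.ff p q hpq)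
      rwa [one_smul] at this
    · exact (key q p (far_comm.1 hpq) h).symm
  · exact key p q hpq h'

lemma T_e_serre (i p q : Vertex n) (hpq : Adj p q) :
    TE i p ^ 2 * TE i q - (v + v⁻¹) • (TE i p * TE i q * TE i p) + TE i q * TE i p ^ 2 = 0 := by
  have h0 := v_ne_zero
  rw [← two_eq]
  rcases cases3 i p with rfl | h | h
  · refine serre_of_first (inv_ne_zero h0) (TE_TE hpq) ?_
    rw [TE_self, inv_inv]
    have e1 : Kinv i * E q = v ^ (1 : ℤ) • (E q * Kinv i) := by
      simpa [cartan_adj hpq] using Kinv_E (i := i) (j := q)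
    have e2 := satisfies.ef_ne q i hpq.ne.symm
    linear_combination (norm := skip) -(e1 * F i) + Kinv i * e2
    simp only [mul_sub, sub_mul, smul_mul_assoc, zpow_one, neg_mul, mul_neg, smul_neg,
          mul_smul_comm, smul_sub, smul_smul, mul_assoc, zero_mul, mul_zero]
    match_scalars <;> ring
  · rcases cases3 i q with rfl | h' | h'
    · refine serre_of_second (inv_ne_zero h0) (TE_TE h) ?_
      rw [TE_adj h, inv_inv]
      have e1 := satisfies.e_serre p i hpq
      linear_combination (norm := skip) e1
      simp only [pow_two, mul_sub, sub_mul, smul_mul_assoc, add_smul,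
          mul_smul_comm, smul_sub, smul_smul, mul_assoc]
      match_scalars <;> field_simp <;> ring
    · exact absurd hpq (far_of_adj_adj h h' hpq.ne).not_adj
    · rw [TE_adj h, TE_far h']
      exact serre_far_left (inv_ne_zero h0) v_inv_sq_ne
        (by rw [two_eq]; exact satisfies.e_serre i p h)
        (by rw [two_eq]; exact satisfies.e_serre p q hpq) (satisfies.ee i q h')
  · rcases cases3 i q with rfl | h' | h'
    · exact absurd (adj_comm.1 hpq) h.not_adj
    · rw [TE_adj h', TE_far h, two_eq]
      have e1 := satisfies.e_serre p q hpq
      have e2 := satisfies.ee i p h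
      linear_combination (norm := skip) e1 * E i - v⁻¹ • (E i * e1)
        + E q * E p * e2 + E q * e2 * E p - (v + v⁻¹) • (E p * E q * e2)
        + v⁻¹ • (E p * e2 * E q + e2 * E p * E q - (v + v⁻¹) • (e2 * E q * E p))
      simp only [pow_two, mul_sub, sub_mul, smul_mul_assoc, mul_add, add_mul, smul_add,
          mul_smul_comm, smul_sub, smul_smul, mul_assoc, zero_mul, mul_zero, smul_zero]
      match_scalars <;> field_simp <;> ring
    · rw [TE_far h, TE_far h', two_eq]
      exact satisfies.e_serre p q hpq

lemma T_f_serre (i p q : Vertex n) (hpq : Adj p q) :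
    TF i p ^ 2 * TF i q - (v + v⁻¹) • (TF i p * TF i q * TF i p) + TF i q * TF i p ^ 2 = 0 := by
  have h0 := v_ne_zero
  rcases cases3 i p with rfl | h | h
  · refine serre_of_second h0 (TF_TF hpq) ?_
    rw [TF_self]
    have e1 : K i * F q = v ^ (1 : ℤ) • (F q * K i) := by
      simpa [Wt, cartan_adj hpq] using wt_F i q
    have e2 := satisfies.ef_ne i q hpq.ne
    linear_combination (norm := skip) v⁻¹ • (E i * e1) + e2 * K i
    simp only [mul_sub, sub_mul, smul_mul_assoc, zpow_one, neg_mul, mul_neg, smul_neg,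
          mul_smul_comm, smul_sub, smul_smul, mul_assoc, zero_mul, mul_zero]
    match_scalars <;> field_simp <;> ring
  · rcases cases3 i q with rfl | h' | h'
    · refine serre_of_first h0 (TF_TF h) ?_
      rw [TF_adj h]
      have e1 := satisfies.f_serre p i hpq
      linear_combination (norm := skip) e1
      simp only [pow_two, mul_sub, sub_mul, smul_mul_assoc, add_smul, smul_add, neg_smul,
          mul_smul_comm, smul_sub, smul_smul, mul_assoc, smul_zero]
      match_scalars <;> field_simp <;> ring
    · exact absurd hpq (far_of_adj_adj h h' hpq.ne).not_adj
    · rw [TF_adj h, TF_far h']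
      exact serre_far_right h0 v_sq_ne (satisfies.f_serre i p h)
        (satisfies.f_serre p q hpq) (satisfies.ff i q h')
  · rcases cases3 i q with rfl | h' | h'
    · exact absurd (adj_comm.1 hpq) h.not_adj
    · rw [TF_adj h', TF_far h]
      have e1 := satisfies.f_serre p q hpq
      have e2 := satisfies.ff i p h
      linear_combination (norm := skip) F i * e1 - v • (e1 * F i)
        - F p * e2 * F q - e2 * F p * F q + (v + v⁻¹) • (e2 * F q * F p)
        - v • (F q * F p * e2 + F q * e2 * F p - (v + v⁻¹) • (F p * F q * e2))
      simp only [pow_two, mul_sub, sub_mul, smul_mul_assoc, mul_add, add_mul, smul_add,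
          mul_smul_comm, smul_sub, smul_smul, mul_assoc, zero_mul, mul_zero, smul_zero]
      match_scalars <;> field_simp <;> ring
    · rw [TF_far h, TF_far h']
      exact satisfies.f_serre p q hpq

lemma T_satisfies (i : Vertex n) :
    Satisfies (TE i) (TF i) (fun j => (TK i j : QuantumGroup n))
      (fun j => ((TK i j)⁻¹ : (QuantumGroup n)ˣ)) where
  kk p q := by
    have hc : Commute (TK i p) (TK i q) := by
      have h : ∀ a b : Vertex n, Commute (Ku a) (Ku b) := Ku_comm
      exact ((h _ _).mul_right ((h _ _).zpow_right _)).mul_left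
        (((h _ _).mul_right ((h _ _).zpow_right _)).zpow_left _)
    exact congrArg Units.val hc.eq
  kk' p := Units.mul_inv _
  k'k p := Units.inv_mul _
  ke p q := (wt_TK_TE i p q).conj
  kf p q := (wt_TK_TF i p q).conj
  ef_self := T_ef_self i
  ef_ne := T_ef_ne i
  e_serre := T_e_serre i
  f_serre := T_f_serre i
  ee := T_ee i
  ff := T_ff i

end TRelations

section Automorphism
open MulOpposite

/-- The antiautomorphism fixing `E_i`, `F_i` and inverting `K_i`. -/
def anti (n : ℕ) : QuantumGroup n →ₐ[Qv] (QuantumGroup n)ᵐᵒᵖ :=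
  lift (e := fun i => op (E i)) (f := fun i => op (F i)) (k := fun i => op (Kinv i))
    (k' := fun i => op (K i))
    { kk := fun i j => unop_injective <| by
        have := ((show Commute (Ku j) (Ku i) from Ku_comm j i).inv_left).inv_right.eq
        exact congrArg Units.val this
      kk' := fun i => unop_injective (satisfies.kk' i)
      k'k := fun i => unop_injective (satisfies.k'k i)
      ke := fun i j => unop_injective <| by
        simpa [mul_assoc] using satisfies.ke i j
      kf := fun i j => unop_injective <| by
        simpa [mul_assoc] using satisfies.kf i j
      ef_self := fun i => unop_injective <| by
        have := satisfies.ef_self i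
        rw [← neg_inj, neg_sub, ← smul_neg, neg_sub] at this
        simpa using this
      ef_ne := fun i j h => unop_injective <| by
        have := satisfies.ef_ne i j h
        rw [← neg_inj, neg_sub, neg_zero] at this
        simpa using this
      e_serre := fun i j h => unop_injective <| by
        have := satisfies.e_serre i j h
        simp only [unop_add, unop_sub, unop_mul, unop_smul, unop_pow, unop_op, unop_zero]
        rw [← this, mul_assoc]; abel
      f_serre := fun i j h => unop_injective <| by
        have := satisfies.f_serre i j h
        simp only [unop_add, unop_sub, unop_mul, unop_smul, unop_pow, unop_op, unop_zero]
        rw [← this, mul_assoc]; abel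
      ee := fun i j h => unop_injective (satisfies.ee i j h).symm
      ff := fun i j h => unop_injective (satisfies.ff i j h).symm }

/-- Lusztig's homomorphism `T_i`. -/
def THom (i : Vertex n) : QuantumGroup n →ₐ[Qv] QuantumGroup n := lift (T_satisfies i)

/-- The homomorphism obtained from `T_i` by conjugation with the antiautomorphism. -/
def TInvHom (i : Vertex n) : QuantumGroup n →ₐ[Qv] QuantumGroup n :=
  (AlgHom.opComm (anti n)).comp ((AlgHom.op (THom i)).comp (anti n))

@[simp] lemma anti_E (i : Vertex n) : anti n (E i) = op (E i) := lift_E ..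
@[simp] lemma anti_F (i : Vertex n) : anti n (F i) = op (F i) := lift_F ..
@[simp] lemma anti_K (i : Vertex n) : anti n (K i) = op (Kinv i) := lift_K ..
@[simp] lemma anti_Kinv (i : Vertex n) : anti n (Kinv i) = op (K i) := lift_Kinv ..

lemma anti_anti (x : QuantumGroup n) : unop (anti n (unop (anti n x))) = x := by
  have : (AlgHom.opComm (anti n)).comp (anti n) = AlgHom.id Qv _ := by
    apply hom_ext <;> intro i <;> simp [AlgHom.opComm]
  exact DFunLike.congr_fun this x

lemma TInvHom_apply (i : Vertex n) (x : QuantumGroup n) :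
    TInvHom i x = unop (anti n (THom i (unop (anti n x)))) := rfl

@[simp] lemma THom_E (i j : Vertex n) : THom i (E j) = TE i j := lift_E ..
@[simp] lemma THom_F (i j : Vertex n) : THom i (F j) = TF i j := lift_F ..
@[simp] lemma THom_K (i j : Vertex n) : THom i (K j) = TK i j := lift_K ..
@[simp] lemma THom_Kinv (i j : Vertex n) :
    THom i (Kinv j) = ((TK i j)⁻¹ : (QuantumGroup n)ˣ) := lift_Kinv ..

lemma THom_TInvHom (i : Vertex n) (x : QuantumGroup n) : THom i (TInvHom i x) = x := by
  have : (THom i).comp (TInvHom i) = AlgHom.id Qv (QuantumGroup n) := by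
    apply hom_ext <;> intro j <;> simp only [AlgHom.comp_apply, AlgHom.id_apply, TInvHom_apply,
      anti_E, anti_F, anti_K, anti_Kinv, unop_op, THom_E, THom_F, THom_K, THom_Kinv]
    · rcases cases3 i j with rfl | h | h
      · have e := satisfies.kk' i
        simp [TE_self, TF_self, TK_self, mul_assoc, e]
      · have e := TE_TE h
        rw [TE_adj h]
        simpa using e
      · simp [TE_far h]
    · rcases cases3 i j with rfl | h | h
      · have e := satisfies.kk' i
        simp [TE_self, TF_self, TK_self, ← mul_assoc, e]
      · have e := TF_TF h
        rw [TF_adj h]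
        simpa using e
      · simp [TF_far h]
    · rcases cases3 i j with rfl | h | h
      · simp [TK_self]
      · have e := satisfies.kk' i
        simp [TK_adj h, TK_self, mul_assoc, e]
      · simp [TK_far h]
    · rcases cases3 i j with rfl | h | h
      · simp [TK_self]
      · have e := satisfies.kk' i
        simp [TK_adj h, TK_self, ← mul_assoc, e]
      · simp [TK_far h]
  exact DFunLike.congr_fun this x

lemma TInvHom_THom (i : Vertex n) (x : QuantumGroup n) : TInvHom i (THom i x) = x := by
  have := THom_TInvHom i (unop (anti n x))
  rw [TInvHom_apply, anti_anti] at this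
  rw [TInvHom_apply, this, anti_anti]

end Automorphism

/-- Lusztig's automorphism `T_i` of `U_v(g)`. It is determined by its values `TE i j`, `TF i j` and
`TK i j` at the generators `E_j`, `F_j` and `K_j`. -/
def T (i : Vertex n) : QuantumGroup n ≃ₐ[Qv] QuantumGroup n :=
  AlgEquiv.ofAlgHom (THom i) (TInvHom i) (AlgHom.ext (THom_TInvHom i))
    (AlgHom.ext (TInvHom_THom i))

theorem T_E (i j : Vertex n) : T i (E j) = TE i j := THom_E i j
theorem T_F (i j : Vertex n) : T i (F j) = TF i j := THom_F i j
theorem T_K (i j : Vertex n) : T i (K j) = (Ku j * Ku i ^ (-cartan i j) : (QuantumGroup n)ˣ) :=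
  THom_K i j

/-- The subalgebra `U_v(n)` of `U_v(g)` generated by the `E_i`. -/
def positivePart (n : ℕ) : Subalgebra Qv (QuantumGroup n) := Algebra.adjoin Qv (Set.range E)

end QuantumGroup

/-! ### The embedding into the quantum shuffle algebra -/

section Commutators
variable {A : Type*} [Ring A] [Algebra Qv A] {e f k k' : Vertex n → A}

lemma comm_ff (hk : ∀ i j, k i * f j = v ^ (-cartan i j) • (f j * k i))
    (hk' : ∀ i j, k' i * f j = v ^ cartan i j • (f j * k' i))
    (he : ∀ i, e i * f i - f i * e i = (v - v⁻¹)⁻¹ • (k i - k' i))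
    (hne : ∀ i j, i ≠ j → e i * f j - f j * e i = 0) {i j : Vertex n} (h : Far i j)
    (l : Vertex n) :
    e l * (f i * f j - f j * f i) = (f i * f j - f j * f i) * e l := by
  have key : ∀ i j : Vertex n, Far i j →
      e i * (f i * f j - f j * f i) = (f i * f j - f j * f i) * e i := by
    intro i j h
    have e1 := he i
    have e2 := hne i j h.ne
    have k1 : k i * f j = f j * k i := by simpa [cartan_far h] using hk i j
    have k2 : k' i * f j = f j * k' i := by simpa [cartan_far h] using hk' i j
    linear_combination (norm := skip) e1 * f j + f i * e2 - e2 * f i - f j * e1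
      + (v - v⁻¹)⁻¹ • (k1 - k2)
    simp only [mul_sub, sub_mul, smul_mul_assoc, mul_smul_comm, smul_sub, smul_smul, mul_assoc,
      zero_mul, mul_zero]
    match_scalars <;> ring
  by_cases h1 : l = i
  · subst h1; exact key l j h
  by_cases h2 : l = j
  · subst h2
    have := key l i (far_comm.1 h)
    rw [← neg_inj, ← mul_neg, ← neg_mul, neg_sub] at this
    exact this
  have e1 := hne l i h1
  have e2 := hne l j h2
  linear_combination (norm := skip) e1 * f j + f i * e2 - e2 * f i - f j * e1
  noncomm_ring

lemma comm_serre (hk : ∀ i j, k i * f j = v ^ (-cartan i j) • (f j * k i))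
    (hk' : ∀ i j, k' i * f j = v ^ cartan i j • (f j * k' i))
    (he : ∀ i, e i * f i - f i * e i = (v - v⁻¹)⁻¹ • (k i - k' i))
    (hne : ∀ i j, i ≠ j → e i * f j - f j * e i = 0) {i j : Vertex n} (h : Adj i j)
    (l : Vertex n) :
    e l * (f i ^ 2 * f j - (v + v⁻¹) • (f i * f j * f i) + f j * f i ^ 2) =
      (f i ^ 2 * f j - (v + v⁻¹) • (f i * f j * f i) + f j * f i ^ 2) * e l := by
  have h0 := v_ne_zero
  by_cases h1 : l = i
  · subst h1
    have e1 := he l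
    have e2 := hne l j h.ne
    have k1 : k l * f l = v ^ (-2 : ℤ) • (f l * k l) := by simpa using hk l l
    have k2 : k l * f j = v ^ (1 : ℤ) • (f j * k l) := by simpa [cartan_adj h] using hk l j
    have m1 : k' l * f l = v ^ (2 : ℤ) • (f l * k' l) := by simpa using hk' l l
    have m2 : k' l * f j = v ^ (-1 : ℤ) • (f j * k' l) := by simpa [cartan_adj h] using hk' l j
    generalize (v - v⁻¹)⁻¹ = c at *
    generalize f l = x at *
    generalize f j = y at *
    linear_combination (norm := skip) e1 * x * y + x * e1 * y + x * x * e2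
      - (v + v⁻¹) • (e1 * y * x + x * e2 * x + x * y * e1) + e2 * x * x + y * e1 * x + y * x * e1
      + c • (k1 * y + v ^ (-2 : ℤ) • (x * k2) + x * k2
        - (v + v⁻¹) • (k2 * x + v • (y * k1)) + y * k1)
      - c • (m1 * y + v ^ (2 : ℤ) • (x * m2) + x * m2
        - (v + v⁻¹) • (m2 * x + v⁻¹ • (y * m1)) + y * m1)
    simp only [pow_two x, mul_add, add_mul, mul_sub, sub_mul, smul_mul_assoc, mul_smul_comm,
      smul_sub, smul_add, smul_smul, mul_assoc, zero_mul, mul_zero, smul_zero]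
    match_scalars <;> field_simp <;> ring
  by_cases h2 : l = j
  · subst h2
    have e1 := hne l i h1
    have e2 := he l
    have k1 : k l * f i = v ^ (1 : ℤ) • (f i * k l) := by
      simpa [cartan_adj (adj_comm.1 h)] using hk l i
    have m1 : k' l * f i = v ^ (-1 : ℤ) • (f i * k' l) := by
      simpa [cartan_adj (adj_comm.1 h)] using hk' l i
    generalize (v - v⁻¹)⁻¹ = c at *
    generalize f l = y at *
    generalize f i = x at *
    linear_combination (norm := skip) e1 * x * y + x * e1 * y + x * x * e2
      - (v + v⁻¹) • (e1 * y * x + x * e2 * x + x * y * e1) + e2 * x * x + y * e1 * x + y * x * e1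
      + c • (k1 * x + v • (x * k1) - (v + v⁻¹) • (x * k1))
      - c • (m1 * x + v⁻¹ • (x * m1) - (v + v⁻¹) • (x * m1))
    simp only [pow_two x, mul_add, add_mul, mul_sub, sub_mul, smul_mul_assoc, mul_smul_comm,
      smul_sub, smul_add, smul_smul, mul_assoc, zero_mul, mul_zero, smul_zero]
    match_scalars <;> field_simp <;> ring
  have e1 := hne l i h1
  have e2 := hne l j h2
  generalize f j = y at *
  generalize f i = x at *
  linear_combination (norm := skip) e1 * x * y + x * e1 * y + x * x * e2
      - (v + v⁻¹) • (e1 * y * x + x * e2 * x + x * y * e1) + e2 * x * x + y * e1 * x + y * x * e1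
  simp only [pow_two x, mul_add, add_mul, mul_sub, sub_mul, smul_mul_assoc, mul_smul_comm,
      smul_sub, smul_add, smul_smul, mul_assoc, zero_mul, mul_zero, smul_zero]
  match_scalars <;> ring

end Commutators

namespace ShuffleAlgebra

lemma hom_ext_word {M : Type*} [AddCommGroup M] [Module Qv M] {φ ψ : ShuffleAlgebra n →ₗ[Qv] M}
    (h : ∀ u, φ (word u) = ψ (word u)) : φ = ψ := (basis n).ext h

/-- The inverse of `scale`. -/
def scaleInv (a : Vertex n) : ShuffleAlgebra n →ₗ[Qv] ShuffleAlgebra n :=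
  (basis n).constr Qv fun u => v ^ (-pair a u) • word u

@[simp] lemma scaleInv_word (a : Vertex n) (u : List (Vertex n)) :
    scaleInv a (word u) = v ^ (-pair a u) • word u := by
  simp [scaleInv, word]

lemma scale_scaleInv (a : Vertex n) (x : ShuffleAlgebra n) : scale a (scaleInv a x) = x := by
  have : (scale a).comp (scaleInv a) = LinearMap.id := hom_ext_word fun u => by
    have h := zpow_ne_zero (pair a u) v_ne_zero
    simp [smul_smul, h]
  exact LinearMap.congr_fun this x

lemma scaleInv_scale (a : Vertex n) (x : ShuffleAlgebra n) : scaleInv a (scale a x) = x := by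
  have : (scaleInv a).comp (scale a) = LinearMap.id := hom_ext_word fun u => by
    have h := zpow_ne_zero (pair a u) v_ne_zero
    simp [smul_smul, h]
  exact LinearMap.congr_fun this x

lemma scale_comm (a b : Vertex n) (x : ShuffleAlgebra n) :
    scale a (scale b x) = scale b (scale a x) := by
  have : (scale a).comp (scale b) = (scale b).comp (scale a) := hom_ext_word fun u => by
    simp [smul_smul, mul_comm]
  exact LinearMap.congr_fun this x

lemma scaleInv_mul (a : Vertex n) (x y : ShuffleAlgebra n) :
    scaleInv a (x * y) = scaleInv a x * scaleInv a y := by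
  conv_lhs => rw [← scale_scaleInv a x, ← scale_scaleInv a y, ← scale_mul, scaleInv_scale]

/-- Delete the first letter if it is `j`. -/
def dFirst (j : Vertex n) : ShuffleAlgebra n →ₗ[Qv] ShuffleAlgebra n :=
  (basis n).constr Qv fun
    | [] => 0
    | a :: u => if a = j then word u else 0

/-- Delete the last letter of a word if it is `j`. -/
def dLastWord (j : Vertex n) : List (Vertex n) → ShuffleAlgebra n
  | [] => 0
  | [a] => if a = j then word [] else 0
  | a :: b :: u => cons a (dLastWord j (b :: u))

/-- Delete the last letter if it is `j`. -/
def dLast (j : Vertex n) : ShuffleAlgebra n →ₗ[Qv] ShuffleAlgebra n :=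
  (basis n).constr Qv (dLastWord j)

@[simp] lemma dFirst_nil (j : Vertex n) : dFirst j (word []) = 0 := by
  simp [dFirst, word]

@[simp] lemma dFirst_cons_word (j a : Vertex n) (u : List (Vertex n)) :
    dFirst j (word (a :: u)) = if a = j then word u else 0 := by
  simp [dFirst, word]

lemma dFirst_cons (j a : Vertex n) (x : ShuffleAlgebra n) :
    dFirst j (cons a x) = if a = j then x else 0 := by
  induction x using induction_word with
  | hw u => simp
  | h0 => simp
  | ha x y hx hy => rw [map_add, map_add, hx, hy]; split_ifs <;> simp
  | hs c x hx => rw [map_smul, map_smul, hx]; split_ifs <;> simp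

@[simp] lemma dLast_word (j : Vertex n) (u : List (Vertex n)) :
    dLast j (word u) = dLastWord j u := by
  simp [dLast, word]

lemma letter_mul_cons (a b : Vertex n) (y : ShuffleAlgebra n) :
    word [a] * cons b y = cons a (scale a (cons b y)) + cons b (word [a] * y) := by
  have := cons_mul_cons' a b (word []) y
  simpa only [cons_word, one_mul_aux] using this

lemma dFirst_mul (j a : Vertex n) (x : ShuffleAlgebra n) :
    dFirst j (word [a] * x) = (if a = j then scale a x else 0) + word [a] * dFirst j x := by
  induction x using induction_word with
  | hw u =>
    rcases u with _ | ⟨b, u⟩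
    · simp [mul_one_aux, pair]
    · rw [← cons_word b u, letter_mul_cons, map_add, dFirst_cons, dFirst_cons, dFirst_cons]
      split_ifs <;> simp
  | h0 => simp
  | ha x y hx hy => rw [mul_add, map_add, hx, hy, map_add, map_add]; split_ifs <;> simp [mul_add]; abel
  | hs c x hx =>
    rw [mul_smul_comm, map_smul, hx, map_smul, map_smul]; split_ifs <;> simp [mul_smul_comm]

lemma scale_dFirst (j a : Vertex n) (x : ShuffleAlgebra n) :
    scale a (dFirst j x) = v ^ (-cartan a j) • dFirst j (scale a x) := by
  induction x using induction_word with
  | hw u =>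
    rcases u with _ | ⟨b, u⟩
    · simp
    · by_cases h : b = j
      · subst h
        have h := zpow_ne_zero (cartan a b) v_ne_zero
        simp [pair, smul_smul, zpow_add₀ v_ne_zero, ← mul_assoc, h]
      · simp [h]
  | h0 => simp
  | ha x y hx hy => simp only [map_add, hx, hy, smul_add]
  | hs c x hx => simp only [map_smul, hx, smul_comm c]

lemma scale_dLastWord (j a : Vertex n) (u : List (Vertex n)) :
    scale a (dLastWord j u) = v ^ (pair a u - cartan a j) • dLastWord j u := by
  induction u with
  | nil => simp [dLastWord]
  | cons b u ih =>
    rcases u with _ | ⟨c, u⟩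
    · by_cases h : b = j
      · subst h
        simp [dLastWord, pair]
      · simp [dLastWord, h]
    · rw [dLastWord, scale_cons, ih, map_smul, smul_smul, ← zpow_add₀ v_ne_zero]
      congr 2
      simp [pair]; ring

lemma scale_dLast (j a : Vertex n) (x : ShuffleAlgebra n) :
    scale a (dLast j x) = v ^ (-cartan a j) • dLast j (scale a x) := by
  induction x using induction_word with
  | hw u =>
    rw [dLast_word, scale_dLastWord, scale_word, map_smul, dLast_word, smul_smul,
      ← zpow_add₀ v_ne_zero]
    congr 2; ring
  | h0 => simp
  | ha x y hx hy => simp only [map_add, hx, hy, smul_add]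
  | hs c x hx => simp only [map_smul, hx, smul_comm c]

/-- The coefficient of the empty word. -/
def eps (n : ℕ) : ShuffleAlgebra n →ₗ[Qv] Qv :=
  (basis n).constr Qv fun u => if u = [] then 1 else 0

@[simp] lemma eps_word (u : List (Vertex n)) : eps n (word u) = if u = [] then 1 else 0 := by
  simp [eps, word]

lemma eps_cons (a : Vertex n) (x : ShuffleAlgebra n) : eps n (cons a x) = 0 := by
  have : (eps n).comp (cons a) = 0 := hom_ext_word fun u => by simp
  exact LinearMap.congr_fun this x

lemma eps_mul (a : Vertex n) (u : List (Vertex n)) : eps n (word [a] * word u) = 0 := by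
  rcases u with _ | ⟨b, u⟩
  · simp [mul_one_aux]
  · rw [← cons_word b u, letter_mul_cons, map_add, eps_cons, eps_cons, add_zero]

lemma dLast_cons (j a : Vertex n) (x : ShuffleAlgebra n) :
    dLast j (cons a x) = cons a (dLast j x) + eps n x • dLastWord j [a] := by
  induction x using induction_word with
  | hw u => rcases u with _ | ⟨b, u⟩ <;> simp [dLastWord]
  | h0 => simp
  | ha x y hx hy => simp only [map_add, hx, hy, add_smul]; abel
  | hs c x hx => simp only [map_smul, hx, smul_add, smul_smul, smul_eq_mul]

lemma dLast_mul_word (j a : Vertex n) (u : List (Vertex n)) :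
    dLast j (word [a] * word u) =
      (if a = j then word u else 0) + v ^ cartan a j • (word [a] * dLastWord j u) := by
  induction u with
  | nil => simp [mul_one_aux, dLastWord]
  | cons b u ih =>
    rw [← cons_word b u, letter_mul_cons, map_add, dLast_cons j b, ih, eps_mul, zero_smul, add_zero,
      cons_word, scale_word, map_smul, map_smul, cons_word, dLast_word]
    rcases u with _ | ⟨c, u⟩
    · by_cases h : b = j
      · subst h
        by_cases h' : a = b
        · subst h'
          simp [dLastWord, pair, mul_one_aux, add_comm]
        · simp [dLastWord, pair, mul_one_aux, h']
      · by_cases h' : a = j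
        · subst h'
          simp [dLastWord, pair, mul_one_aux, h]
        · simp [dLastWord, pair, mul_one_aux, h', h]
    · have e1 : v ^ pair a (b :: c :: u) • cons a (cons b (dLastWord j (c :: u)))
          = v ^ cartan a j • cons a (scale a (cons b (dLastWord j (c :: u)))) := by
        have := scale_dLastWord j a (b :: c :: u)
        rw [dLastWord] at this
        rw [this, map_smul, smul_smul, ← zpow_add₀ v_ne_zero]
        congr 2; ring
      rw [show dLastWord j (a :: b :: c :: u) = cons a (cons b (dLastWord j (c :: u))) from rfl,
        show dLastWord j (b :: c :: u) = cons b (dLastWord j (c :: u)) from rfl, e1,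
        letter_mul_cons, map_add, map_smul, smul_add]
      split_ifs <;> simp
      abel

lemma dLast_mul (j a : Vertex n) (x : ShuffleAlgebra n) :
    dLast j (word [a] * x) =
      (if a = j then x else 0) + v ^ cartan a j • (word [a] * dLast j x) := by
  induction x using induction_word with
  | hw u => rw [dLast_mul_word, dLast_word]
  | h0 => simp
  | ha x y hx hy => rw [mul_add, map_add, hx, hy, map_add]; split_ifs <;> simp [mul_add]; abel
  | hs c x hx =>
    rw [mul_smul_comm, map_smul, hx, map_smul]
    split_ifs <;> simp [mul_smul_comm, smul_comm c]

/-- The operator by which `F_j` acts on words. -/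
def opF (j : Vertex n) : ShuffleAlgebra n →ₗ[Qv] ShuffleAlgebra n :=
  -((v - v⁻¹)⁻¹ • (dFirst j - (scaleInv j).comp (dLast j)))

lemma scale_scaleInv_comm (a b : Vertex n) (x : ShuffleAlgebra n) :
    scale a (scaleInv b x) = scaleInv b (scale a x) := by
  conv_lhs => rw [← scaleInv_scale b (scale a (scaleInv b x)), scale_comm, scale_scaleInv]

lemma scale_opF (j a : Vertex n) (x : ShuffleAlgebra n) :
    scale a (opF j x) = v ^ (-cartan a j) • opF j (scale a x) := by
  simp only [opF, LinearMap.neg_apply, LinearMap.smul_apply, LinearMap.sub_apply,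
    LinearMap.comp_apply, map_neg, map_smul, map_sub, scale_dFirst, scale_scaleInv_comm,
    scale_dLast, smul_neg, smul_sub, smul_smul, mul_comm]

lemma mul_opF (j a : Vertex n) (x : ShuffleAlgebra n) :
    word [a] * opF j x - opF j (word [a] * x) =
      if a = j then (v - v⁻¹)⁻¹ • (scale a x - scaleInv a x) else 0 := by
  have h1 : scaleInv j (word [a]) = v ^ (-cartan a j) • word [a] := by
    simp [pair, cartan_comm a j]
  have h2 : v ^ cartan a j * v ^ (-cartan a j) = 1 := by
    rw [← zpow_add₀ v_ne_zero]; simp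
  simp only [opF, LinearMap.neg_apply, LinearMap.smul_apply, LinearMap.sub_apply,
    LinearMap.comp_apply, dFirst_mul, dLast_mul, map_add, map_smul, scaleInv_mul, h1,
    smul_mul_assoc, smul_smul, h2, one_smul]
  split_ifs with h
  · subst h
    simp only [mul_neg, mul_sub, mul_smul_comm, smul_sub, smul_add]
    abel
  · simp only [mul_neg, mul_sub, mul_smul_comm, smul_sub, smul_add, map_zero]
    abel

lemma opF_one (j : Vertex n) : opF j 1 = 0 := by
  change opF j (word []) = 0
  simp [opF, dLastWord]

lemma letter_ee (i j : Vertex n) (h : Far i j) :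
    word [i] * word [j] = word [j] * word [i] := by
  simp [cons_mul_cons, pair, cartan_far h, cartan_far (far_comm.1 h), one_mul_aux, mul_one_aux]
  abel

lemma letter_serre (i j : Vertex n) (h : Adj i j) :
    word [i] ^ 2 * word [j] - (v + v⁻¹) • (word [i] * word [j] * word [i])
      + word [j] * word [i] ^ 2 = 0 := by
  have h0 := v_ne_zero
  simp only [pow_two, mul_assoc]
  simp only [cons_mul_cons, pair, cartan_adj h, cartan_adj (adj_comm.1 h), cartan_self,
    one_mul_aux, mul_one_aux, mul_add, mul_smul_comm, cons_word, map_add, map_smul, List.map_cons,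
    List.map_nil, List.sum_cons, List.sum_nil, smul_add, smul_smul, add_zero,
    zpow_add₀ v_ne_zero, zpow_neg, zpow_one, zpow_ofNat]
  match_scalars <;> field_simp <;> ring

end ShuffleAlgebra

/-- The subalgebra of the shuffle algebra generated by the words of length one. -/
def shuffleSub (n : ℕ) : Subalgebra Qv (ShuffleAlgebra n) :=
  Algebra.adjoin Qv (Set.range fun i => ShuffleAlgebra.word [i])

namespace ShuffleSub
open ShuffleAlgebra

/-- The words of length one, as elements of the subalgebra. -/
def letter (i : Vertex n) : shuffleSub n := ⟨word [i], Algebra.subset_adjoin ⟨i, rfl⟩⟩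

lemma induction_letter {P : ShuffleAlgebra n → Prop} (h1 : P 1)
    (ha : ∀ x y, P x → P y → P (x + y)) (hs : ∀ (c : Qv) x, P x → P (c • x))
    (hl : ∀ i x, P x → P (word [i] * x)) (x : ShuffleAlgebra n) (hx : x ∈ shuffleSub n) : P x := by
  suffices h : ∀ y, P y → P (x * y) by simpa using h 1 h1
  refine Algebra.adjoin_induction (R := Qv) (s := Set.range fun i : Vertex n => word [i])
    (p := fun x _ => ∀ y, P y → P (x * y)) ?_ ?_ ?_ ?_ hx
  · rintro _ ⟨i, rfl⟩ y hy
    exact hl i y hy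
  · intro c y hy
    rw [← Algebra.smul_def]
    exact hs c y hy
  · intro x z _ _ h h' y hy
    rw [add_mul]
    exact ha _ _ (h y hy) (h' y hy)
  · intro x z _ _ h h' y hy
    rw [mul_assoc]
    exact h _ (h' y hy)

lemma scale_mem (a : Vertex n) (x : ShuffleAlgebra n) (hx : x ∈ shuffleSub n) :
    scale a x ∈ shuffleSub n := by
  refine induction_letter (P := fun x => scale a x ∈ shuffleSub n) ?_ ?_ ?_ ?_ x hx
  · change scale a (word []) ∈ _
    rw [scale_word]
    exact Subalgebra.smul_mem _ (one_mem _) _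
  · intro x y hx hy
    rw [map_add]
    exact add_mem hx hy
  · intro c x hx
    rw [map_smul]
    exact Subalgebra.smul_mem _ hx _
  · intro i x hx
    rw [scale_mul, scale_word]
    exact mul_mem (Subalgebra.smul_mem _ (letter i).2 _) hx

lemma scaleInv_mem (a : Vertex n) (x : ShuffleAlgebra n) (hx : x ∈ shuffleSub n) :
    scaleInv a x ∈ shuffleSub n := by
  refine induction_letter (P := fun x => scaleInv a x ∈ shuffleSub n) ?_ ?_ ?_ ?_ x hx
  · change scaleInv a (word []) ∈ _
    rw [scaleInv_word]
    exact Subalgebra.smul_mem _ (one_mem _) _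
  · intro x y hx hy
    rw [map_add]
    exact add_mem hx hy
  · intro c x hx
    rw [map_smul]
    exact Subalgebra.smul_mem _ hx _
  · intro i x hx
    rw [scaleInv_mul, scaleInv_word]
    exact mul_mem (Subalgebra.smul_mem _ (letter i).2 _) hx

lemma opF_mem (j : Vertex n) (x : ShuffleAlgebra n) (hx : x ∈ shuffleSub n) :
    opF j x ∈ shuffleSub n := by
  have : x ∈ shuffleSub n ∧ opF j x ∈ shuffleSub n := by
    refine induction_letter (P := fun x => x ∈ shuffleSub n ∧ opF j x ∈ shuffleSub n)
      ?_ ?_ ?_ ?_ x hx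
    · exact ⟨one_mem _, by rw [opF_one]; exact zero_mem _⟩
    · intro x y hx hy
      rw [map_add]
      exact ⟨add_mem hx.1 hy.1, add_mem hx.2 hy.2⟩
    · intro c x hx
      rw [map_smul]
      exact ⟨Subalgebra.smul_mem _ hx.1 _, Subalgebra.smul_mem _ hx.2 _⟩
    · intro i x hx
      refine ⟨mul_mem (letter i).2 hx.1, ?_⟩
      have h := mul_opF j i x
      rw [sub_eq_iff_eq_add', ← sub_eq_iff_eq_add] at h
      rw [← h]
      refine sub_mem (mul_mem (letter i).2 hx.2) ?_
      split_ifs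
      · exact Subalgebra.smul_mem _ (sub_mem (scale_mem _ _ hx.1) (scaleInv_mem _ _ hx.1)) _
      · exact zero_mem _
  exact this.2

/-- The operators by which the generators of `U_v(g)` act on the subalgebra. -/
def actE (i : Vertex n) : Module.End Qv (shuffleSub n) := LinearMap.mulLeft Qv (letter i)
/-- The action of `F_i`. -/
def actF (i : Vertex n) : Module.End Qv (shuffleSub n) :=
  (opF i).restrict (p := (shuffleSub n).toSubmodule) (q := (shuffleSub n).toSubmodule) (opF_mem i)
/-- The action of `K_i`. -/
def actK (i : Vertex n) : Module.End Qv (shuffleSub n) :=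
  (scale i).restrict (p := (shuffleSub n).toSubmodule) (q := (shuffleSub n).toSubmodule)
    (scale_mem i)
/-- The action of `K_i⁻¹`. -/
def actKinv (i : Vertex n) : Module.End Qv (shuffleSub n) :=
  (scaleInv i).restrict (p := (shuffleSub n).toSubmodule) (q := (shuffleSub n).toSubmodule)
    (scaleInv_mem i)

@[simp] lemma coe_actE (i : Vertex n) (x : shuffleSub n) :
    (actE i x : ShuffleAlgebra n) = word [i] * x := rfl
@[simp] lemma coe_actF (i : Vertex n) (x : shuffleSub n) :
    (actF i x : ShuffleAlgebra n) = opF i x := rfl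
@[simp] lemma coe_actK (i : Vertex n) (x : shuffleSub n) :
    (actK i x : ShuffleAlgebra n) = scale i x := rfl
@[simp] lemma coe_actKinv (i : Vertex n) (x : shuffleSub n) :
    (actKinv i x : ShuffleAlgebra n) = scaleInv i x := rfl

lemma end_ext {φ ψ : Module.End Qv (shuffleSub n)}
    (h : ∀ x : shuffleSub n, (φ x : ShuffleAlgebra n) = ψ x) : φ = ψ :=
  LinearMap.ext fun x => Subtype.ext (h x)

lemma act_kf (i j : Vertex n) : actK i * actF j = v ^ (-cartan i j) • (actF j * actK i) :=
  end_ext fun x => by simpa using scale_opF j i x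

lemma act_kk' (i : Vertex n) : actK i * actKinv i = 1 :=
  end_ext fun x => by simpa using scale_scaleInv i (x : ShuffleAlgebra n)

lemma act_k'k (i : Vertex n) : actKinv i * actK i = 1 :=
  end_ext fun x => by simpa using scaleInv_scale i (x : ShuffleAlgebra n)

lemma act_k'f (i j : Vertex n) : actKinv i * actF j = v ^ cartan i j • (actF j * actKinv i) := by
  have h := act_kf i j
  calc actKinv i * actF j = v ^ cartan i j • (actKinv i * (v ^ (-cartan i j) • (actF j * actK i))
        * actKinv i) := by
        simp only [mul_smul_comm, smul_mul_assoc, smul_smul, ← zpow_add₀ v_ne_zero, mul_assoc,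
          act_kk', mul_one, add_neg_cancel, zpow_zero, one_smul]
    _ = v ^ cartan i j • (actF j * actKinv i) := by
        rw [← h, ← mul_assoc, act_k'k, one_mul]

lemma act_ef_self (i : Vertex n) :
    actE i * actF i - actF i * actE i = (v - v⁻¹)⁻¹ • (actK i - actKinv i) :=
  end_ext fun x => by simpa using mul_opF i i x

lemma act_ef_ne (i j : Vertex n) (h : i ≠ j) : actE i * actF j - actF j * actE i = 0 :=
  end_ext fun x => by simpa [h] using mul_opF j i x

lemma act_eq_zero {s : Module.End Qv (shuffleSub n)} (h1 : s 1 = 0)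
    (h : ∀ l, actE l * s = s * actE l) : s = 0 := by
  have key : ∀ x (hx : x ∈ shuffleSub n), ∃ hx : x ∈ shuffleSub n, s ⟨x, hx⟩ = 0 := by
    intro x hx
    refine induction_letter (P := fun x => ∃ hx : x ∈ shuffleSub n, s ⟨x, hx⟩ = 0)
      ⟨one_mem _, h1⟩ ?_ ?_ ?_ x hx
    · rintro x y ⟨hx, hx'⟩ ⟨hy, hy'⟩
      refine ⟨add_mem hx hy, ?_⟩
      have := map_add s ⟨x, hx⟩ ⟨y, hy⟩
      rw [hx', hy', add_zero] at this
      exact this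
    · rintro c x ⟨hx, hx'⟩
      refine ⟨Subalgebra.smul_mem _ hx _, ?_⟩
      have := map_smul s c ⟨x, hx⟩
      rw [hx', smul_zero] at this
      exact this
    · rintro i x ⟨hx, hx'⟩
      refine ⟨mul_mem (letter i).2 hx, ?_⟩
      have := LinearMap.congr_fun (h i) ⟨x, hx⟩
      simp only [Module.End.mul_apply, hx', map_zero] at this
      exact this.symm
  refine LinearMap.ext fun x => ?_
  obtain ⟨_, h⟩ := key x x.2
  exact h

lemma act_F_one (i : Vertex n) : actF i 1 = 0 := Subtype.ext (opF_one i)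

lemma act_ke (i j : Vertex n) : actK i * actE j * actKinv i = v ^ cartan i j • actE j :=
  end_ext fun x => by
    change scale i (word [j] * scaleInv i x) = v ^ cartan i j • (word [j] * (x : ShuffleAlgebra n))
    rw [scale_mul, scale_scaleInv, scale_word, smul_mul_assoc]
    simp [pair]

lemma act_e (i : Vertex n) : actE i = Algebra.lmul Qv (shuffleSub n) (letter i) := rfl

lemma act_e_serre (i j : Vertex n) (h : Adj i j) : actE i ^ 2 * actE j
    - (v + v⁻¹) • (actE i * actE j * actE i) + actE j * actE i ^ 2 = 0 := by
  have h2 : letter i ^ 2 * letter j - (v + v⁻¹) • (letter i * letter j * letter i)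
      + letter j * letter i ^ 2 = 0 := Subtype.ext (letter_serre i j h)
  simpa only [map_add, map_sub, map_mul, map_pow, map_smul, map_zero, ← act_e] using
    congrArg (Algebra.lmul Qv (shuffleSub n)) h2

lemma act_ee (i j : Vertex n) (h : Far i j) : actE i * actE j = actE j * actE i := by
  have h2 : letter i * letter j = letter j * letter i := Subtype.ext (letter_ee i j h)
  simpa only [map_mul, ← act_e] using congrArg (Algebra.lmul Qv (shuffleSub n)) h2

lemma act_f_serre (i j : Vertex n) (h : Adj i j) : actF i ^ 2 * actF j
    - (v + v⁻¹) • (actF i * actF j * actF i) + actF j * actF i ^ 2 = 0 := by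
  have hc := comm_serre (A := Module.End Qv (shuffleSub n)) act_kf act_k'f act_ef_self act_ef_ne h
  refine act_eq_zero ?_ hc
  simp only [pow_two, LinearMap.add_apply, LinearMap.sub_apply, LinearMap.smul_apply,
    Module.End.mul_apply, act_F_one, map_zero, smul_zero, sub_zero, add_zero]

lemma act_ff (i j : Vertex n) (h : Far i j) : actF i * actF j = actF j * actF i := by
  have hc := comm_ff (A := Module.End Qv (shuffleSub n)) act_kf act_k'f act_ef_self act_ef_ne h
  refine sub_eq_zero.1 (act_eq_zero ?_ hc)
  simp only [LinearMap.sub_apply, Module.End.mul_apply, act_F_one, map_zero, sub_zero]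

lemma act_satisfies : Satisfies (A := Module.End Qv (shuffleSub n)) actE actF actK actKinv where
  kk i j := end_ext fun x => scale_comm i j (x : ShuffleAlgebra n)
  kk' := act_kk'
  k'k := act_k'k
  ke := act_ke
  kf i j := by rw [act_kf, smul_mul_assoc, mul_assoc, act_kk', mul_one]
  ef_self := act_ef_self
  ef_ne := act_ef_ne
  e_serre := act_e_serre
  f_serre := act_f_serre
  ee := act_ee
  ff := act_ff

/-- The action of `U_v(g)` on the subalgebra. -/
def action (n : ℕ) : QuantumGroup n →ₐ[Qv] Module.End Qv (shuffleSub n) :=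
  QuantumGroup.lift act_satisfies

lemma action_apply (x : QuantumGroup n) (hx : x ∈ QuantumGroup.positivePart n)
    (y : shuffleSub n) : action n x y = action n x 1 * y := by
  have h : QuantumGroup.positivePart n ≤
      (AlgHom.range (Algebra.lmul Qv (shuffleSub n))).comap (action n) := by
    refine Algebra.adjoin_le ?_
    rintro _ ⟨i, rfl⟩
    exact ⟨letter i, by simp [action, actE]; rfl⟩
  obtain ⟨z, hz⟩ := h hx
  change Algebra.lmul Qv (shuffleSub n) z = action n x at hz
  rw [← hz]
  simp

end ShuffleSub

/-- The homomorphism `U_v(n) → F` of `ℚ(v)`-algebras with `E_i ↦ w[i]`: the algebra `U_v(g)` acts on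
the subalgebra generated by the words of length one in such a way that `E_i` acts as the left
multiplication by `w[i]`; the value at `x` is the result of the action of `x` on the unit. -/
def shuffleHom (n : ℕ) : QuantumGroup.positivePart n →ₐ[Qv] ShuffleAlgebra n :=
  AlgHom.ofLinearMap
    { toFun := fun x => (ShuffleSub.action n x 1 : ShuffleAlgebra n)
      map_add' := fun x y => by simp
      map_smul' := fun c x => by simp }
    (by simp)
    (fun x y => by
      have h := ShuffleSub.action_apply x x.2 (ShuffleSub.action n y 1)
      rw [← Module.End.mul_apply, ← map_mul] at h
      exact congrArg Subtype.val h)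

/-- The generator `E_i` as an element of `U_v(n)`. -/
def posE (i : Vertex n) : QuantumGroup.positivePart n :=
  ⟨QuantumGroup.E i, Algebra.subset_adjoin ⟨i, rfl⟩⟩

theorem shuffleHom_E (i : Vertex n) : shuffleHom n (posE i) = ShuffleAlgebra.word [i] := by
  change ((ShuffleSub.action n (QuantumGroup.E i) 1 : shuffleSub n) : ShuffleAlgebra n) = _
  simp [ShuffleSub.action]

/-- The property `E_i ↦ w[i]` determines the homomorphism. -/
theorem shuffleHom_unique (φ : QuantumGroup.positivePart n →ₐ[Qv] ShuffleAlgebra n)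
    (h : ∀ i, φ (posE i) = ShuffleAlgebra.word [i]) : φ = shuffleHom n := by
  refine AlgHom.adjoin_ext ?_
  rintro _ ⟨i, rfl⟩
  exact (h i).trans (shuffleHom_E i).symm


/-! ### The elements `X_{i,j}` and the alternating permutations -/

/-- The set `{i, i + 1, …, j}`. -/
abbrev Interval (i j : Vertex n) : Type := {k : Vertex n // i ≤ k ∧ k ≤ j}

/-- The vertex `i + p`, where `i ≤ i + p ≤ j`. -/
def vertexAdd (i j : Vertex n) (p : ℕ) (h : (i : ℕ) + p ≤ j) : Vertex n :=
  ⟨i + p, Finset.mem_Icc.2 ⟨by have := (Finset.mem_Icc.1 i.2).1; omega,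
    h.trans (Finset.mem_Icc.1 j.2).2⟩⟩

/-- `X_{i,j} = T_i ^ ((-1) ^ (i-1)) T_{i+1} ^ ((-1) ^ i) ⋯ T_{j-1} ^ ((-1) ^ (j-2)) (E_j)`; the
product is the one of the group of automorphisms, that is, the composition. -/
def X (i j : Vertex n) : QuantumGroup n :=
  (List.ofFn fun p : Fin ((j : ℕ) - i) =>
    QuantumGroup.T (vertexAdd i j p (by omega)) ^ ((-1 : ℤ) ^ ((i : ℕ) + p - 1))).prod
      (QuantumGroup.E j)

/-- The order conditions on a permutation `π` of `{i, …, j}`: for every even `k`, the inverse of `π`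
takes a greater value at `k` than at `k + 1` (if both belong to the interval), and a greater value at
`k` than at `k - 1` (if both belong to the interval). -/
def IsAlternating {i j : Vertex n} (π : Equiv.Perm (Interval i j)) : Prop :=
  (∀ k l : Interval i j, Even ((k : Vertex n) : ℕ) → ((l : Vertex n) : ℕ) = (k : Vertex n) + 1 →
    π⁻¹ k > π⁻¹ l) ∧
  (∀ k l : Interval i j, Even ((k : Vertex n) : ℕ) → ((l : Vertex n) : ℕ) + 1 = (k : Vertex n) →
    π⁻¹ k > π⁻¹ l)

open Classical in
/-- The permutations of `{i, …, j}` that satisfy the order conditions. -/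
def alternatingPerms (i j : Vertex n) : Finset (Equiv.Perm (Interval i j)) :=
  Finset.univ.filter IsAlternating

/-- The sequence `π(i), π(i + 1), …, π(j)`. -/
def permSeq {i j : Vertex n} (π : Equiv.Perm (Interval i j)) : List (Vertex n) :=
  List.ofFn fun p : Fin ((j : ℕ) + 1 - i) =>
    (π ⟨vertexAdd i j p (by omega), by
      refine ⟨?_, ?_⟩ <;> rw [← Subtype.coe_le_coe] <;> simp only [vertexAdd] <;> omega⟩ : Vertex n)

end QuantumShuffle
end

open QuantumShuffle

noncomputable section

namespace QuantumShuffle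

variable {n : ℕ}

/-! ### The elements `X_{i,j}` as iterated `v`-commutators -/

namespace QuantumGroup

/-! The element `X i j` is an iterated `v`-commutator of the generators, and each commutator acts on
words by inserting one new letter on a prescribed side of its neighbour.

Put k = i + 1. By construction X_{i,j} is the image of X_{k,j} under `altT i`, that is, under T_i or
its inverse according to the parity of i. Inductively X_{k,j} is a commutator of E_k with X_{k+1,j}
when k < j. The latter lies in the algebra generated by the E_l with l ≥ i + 2, which `altT i` fixes
and which commutes with E_i. So `altT i` only replaces E_k by the commutator of E_i and E_k, and E_i
can be moved past X_{k+1,j}. This gives X_{i,j} = `bracket i` X_{k,j} (`altT_bracket`,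
`X_eq_bracket`), and in particular X_{i,j} lies in U_v(n).

In the shuffle algebra, a word u that contains each of k, …, j once is multiplied by w[i] by
inserting i at every position. Only the letter k pairs nontrivially with i, so the coefficient is
v⁻¹ or 1, depending on whether k stands on one side of i or the other. Exchanging the factors
exchanges the sides. Hence the two terms of the `v`-commutator cancel when k is on one side and add
up to 1 - v⁻² when it is on the other (`word_bracket_before`, `word_bracket_after`). The side that
survives puts the even one of i, k after the odd one, which is precisely the condition by which an
alternating word of {k, …, j} extends to one of {i, …, j} (`isAltWord_insert_iff`,
`sum_altWords_insert`). Each of the j - i commutators thus contributes one factor 1 - v⁻², and what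
is left is the sum over alternating words (`shuffleHom_X`). -/

lemma T_symm_apply (i : Vertex n) (x : QuantumGroup n) : (T i).symm x = TInvHom i x := rfl

/-- The inverse of T_i is its conjugate by the antiautomorphism `anti`, which fixes every E and
reverses products. So the formula for T_i(E_j) reappears with the factors in the opposite order. -/
lemma T_symm_E_adj {i j : Vertex n} (h : Adj i j) :
    (T i).symm (E j) = E i * E j - v⁻¹ • (E j * E i) := by
  simp [T_symm_apply, TInvHom_apply, TE_adj h]

lemma T_symm_E_far {i j : Vertex n} (h : Far i j) : (T i).symm (E j) = E j := by
  simp [T_symm_apply, TInvHom_apply, TE_far h]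

open Classical in
/-- The `v`-commutator with `E_i`; the parity of `i` determines the order of the factors. -/
def bracket (i : Vertex n) (x : QuantumGroup n) : QuantumGroup n :=
  if Even (i : ℕ) then E i * x - v⁻¹ • (x * E i) else x * E i - v⁻¹ • (E i * x)

lemma bracket_mem (i : Vertex n) {x : QuantumGroup n} {S : Subalgebra Qv (QuantumGroup n)}
    (hi : E i ∈ S) (hx : x ∈ S) : bracket i x ∈ S := by
  unfold bracket
  split_ifs
  · exact sub_mem (mul_mem hi hx) (Subalgebra.smul_mem _ (mul_mem hx hi) _)
  · exact sub_mem (mul_mem hx hi) (Subalgebra.smul_mem _ (mul_mem hi hx) _)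

/-- The automorphism `T_i` for odd `i`, and its inverse for even `i`. -/
def altT (i : Vertex n) : QuantumGroup n ≃ₐ[Qv] QuantumGroup n := T i ^ ((-1 : ℤ) ^ ((i : ℕ) - 1))

lemma altT_of_even {i : Vertex n} (h : Even (i : ℕ)) : altT i = (T i).symm := by
  -- Vertices start at 1, so the natural subtraction i - 1 is not truncated and an even i gives an
  -- odd exponent.
  have h1 := (Finset.mem_Icc.1 i.2).1
  have : Odd ((i : ℕ) - 1) := by
    rcases h with ⟨r, hr⟩
    exact ⟨r - 1, by omega⟩
  rw [altT, this.neg_one_pow, zpow_neg_one]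
  rfl

lemma altT_of_not_even {i : Vertex n} (h : ¬ Even (i : ℕ)) : altT i = T i := by
  have : Even ((i : ℕ) - 1) := by
    rcases Nat.not_even_iff_odd.1 h with ⟨r, hr⟩
    exact ⟨r, by omega⟩
  rw [altT, this.neg_one_pow, zpow_one]

lemma altT_E_adj {i j : Vertex n} (h : Adj i j) : altT i (E j) = bracket i (E j) := by
  unfold bracket
  split_ifs with hi
  · rw [altT_of_even hi, T_symm_E_adj h]
  · rw [altT_of_not_even hi, T_E, TE_adj h]

lemma altT_E_far {i j : Vertex n} (h : Far i j) : altT i (E j) = E j := by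
  by_cases hi : Even (i : ℕ)
  · rw [altT_of_even hi, T_symm_E_far h]
  · rw [altT_of_not_even hi, T_E, TE_far h]

/-! ### Elements supported on vertices far from a given one -/

/-- The subalgebra generated by the `E_k` with `k ≥ m`. -/
def upperPart (n m : ℕ) : Subalgebra Qv (QuantumGroup n) :=
  Algebra.adjoin Qv (E '' {k | m ≤ (k : ℕ)})

lemma E_mem_upperPart {m : ℕ} {k : Vertex n} (h : m ≤ (k : ℕ)) : E k ∈ upperPart n m :=
  Algebra.subset_adjoin ⟨k, h, rfl⟩

lemma upperPart_anti {m l : ℕ} (h : m ≤ l) : upperPart n l ≤ upperPart n m :=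
  Algebra.adjoin_mono (Set.image_mono fun _ hk => h.trans hk)

lemma upperPart_le_positivePart (m : ℕ) : upperPart n m ≤ positivePart n :=
  Algebra.adjoin_mono (Set.image_subset_range _ _)

lemma far_of_add_two_le {i k : Vertex n} (h : (i : ℕ) + 2 ≤ k) : Far i k := by
  unfold Far
  rw [abs_sub_comm]
  exact le_abs.2 (Or.inl (by omega))

lemma adj_of_eq_add_one {i k : Vertex n} (h : (k : ℕ) = i + 1) : Adj i k := by
  unfold Adj
  rw [h]
  simp

/-- The elements fixed by an algebra automorphism form a subalgebra, so it suffices to look at the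
generators, all of which belong to vertices far from i. -/
lemma altT_upperPart {i : Vertex n} {x : QuantumGroup n} (hx : x ∈ upperPart n (i + 2)) :
    altT i x = x := by
  have : upperPart n (i + 2) ≤ AlgHom.equalizer (altT i : QuantumGroup n →ₐ[Qv] QuantumGroup n)
      (AlgHom.id Qv _) := by
    refine Algebra.adjoin_le ?_
    rintro _ ⟨k, hk, rfl⟩
    exact altT_E_far (far_of_add_two_le hk)
  exact this hx

/-- The centralizer of E_i is a subalgebra, so again only the generators matter. -/
lemma E_comm_upperPart {i : Vertex n} {x : QuantumGroup n} (hx : x ∈ upperPart n (i + 2)) :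
    E i * x = x * E i := by
  have : upperPart n (i + 2) ≤ Subalgebra.centralizer Qv {E i} := by
    refine Algebra.adjoin_le ?_
    rintro _ ⟨k, hk, rfl⟩
    rw [SetLike.mem_coe, Subalgebra.mem_centralizer_iff]
    rintro _ rfl
    exact satisfies.ee i k (far_of_add_two_le hk)
  exact (Subalgebra.mem_centralizer_iff _).1 (this hx) _ rfl

/-- Both sides are determined by what happens to E_k. The automorphism fixes x and sends E_k to
`bracket i (E k)`. The map `bracket i` is a combination of left and right multiplication by E_i, so
it commutes with multiplication on either side by anything that commutes with E_i, such as x. Hence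
it too passes through the outer commutator and reaches E_k. -/
lemma altT_bracket {i k : Vertex n} (h : (k : ℕ) = i + 1) {x : QuantumGroup n}
    (hx : x ∈ upperPart n (i + 2)) : altT i (bracket k x) = bracket i (bracket k x) := by
  have hE := altT_E_adj (adj_of_eq_add_one h)
  have hc := E_comm_upperPart hx
  -- The same commutation inside right-associated products, so that `simp` can move every E_i to the
  -- right of x.
  have hc1 : ∀ y, E i * (x * y) = x * (E i * y) := fun y => by rw [← mul_assoc, hc, mul_assoc]
  have hx' := altT_upperPart hx
  by_cases hi : Even (i : ℕ)
  · have hk : ¬ Even (k : ℕ) := by rw [h]; simpa [Nat.even_add_one] using hi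
    simp only [bracket, if_pos hi, if_neg hk, map_sub, map_mul, map_smul, hx'] at hE ⊢
    rw [hE]
    simp only [mul_sub, sub_mul, mul_smul_comm, smul_mul_assoc, mul_assoc, smul_sub, hc, hc1]
    abel
  · have hk : Even (k : ℕ) := by rw [h]; simpa [Nat.even_add_one] using hi
    simp only [bracket, if_neg hi, if_pos hk, map_sub, map_mul, map_smul, hx'] at hE ⊢
    rw [hE]
    simp only [mul_sub, sub_mul, mul_smul_comm, smul_mul_assoc, mul_assoc, smul_sub, hc, hc1]
    abel

end QuantumGroup

open QuantumGroup

/-! ### The recursion for X_{i,j} -/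

lemma X_self (i : Vertex n) : X i i = E i := by
  have h : (List.ofFn fun p : Fin ((i : ℕ) - i) =>
      T (vertexAdd i i p (by omega)) ^ ((-1 : ℤ) ^ ((i : ℕ) + p - 1))) = [] := by
    apply List.eq_nil_of_length_eq_zero
    simp
  rw [X, h]
  simp

/-- The product of automorphisms is composition, so the first factor is applied last. What remains
is the product that defines `X k j`. -/
lemma X_eq_altT {i j k : Vertex n} (hk : (k : ℕ) = i + 1) (hkj : k ≤ j) :
    X i j = altT i (X k j) := by
  have hkj' : (k : ℕ) ≤ j := hkj
  have hlen : (j : ℕ) - i = (j - k) + 1 := by omega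
  unfold X
  rw [List.ofFn_congr hlen, List.ofFn_succ, List.prod_cons, AlgEquiv.mul_apply]
  congr 1
  congr 2
  congr 1
  -- The factor with index p + 1 counted from i is the factor with index p counted from k, with the
  -- same vertex and the same exponent.
  funext p
  have hv : vertexAdd i j (((p.succ : Fin (j - k + 1)).cast hlen.symm : Fin (j - i)) : ℕ)
      (by have := p.2; simp; omega) = vertexAdd k j p (by omega) := by
    apply Subtype.ext
    simp only [vertexAdd, Fin.val_cast, Fin.val_succ]
    omega
  rw [hv]
  congr 2
  simp only [Fin.val_cast, Fin.val_succ]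
  omega

/-- The two claims have to be proved together. The commutator formula at distance d uses the formula
at distance d - 1 to expose E_k, and the membership at distance d - 2 to know that the other factor
is invisible to vertex i. The membership at distance d then follows from the formula and the
membership at distance d - 1. -/
lemma X_mem_and_eq (d : ℕ) : ∀ i j : Vertex n, (j : ℕ) = i + d → X i j ∈ upperPart n i ∧
    ∀ k : Vertex n, (k : ℕ) = i + 1 → k ≤ j → X i j = bracket i (X k j) := by
  induction d using Nat.strong_induction_on with
  | h d ih =>
    intro i j h
    have key : ∀ k : Vertex n, (k : ℕ) = i + 1 → k ≤ j → X i j = bracket i (X k j) := by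
      intro k hk hkj
      rw [X_eq_altT hk hkj]
      -- If k = j, the element X_{k,j} is the bare generator E_k and there is no inner commutator to
      -- move through.
      rcases hkj.eq_or_lt with rfl | hlt
      · rw [X_self, altT_E_adj (adj_of_eq_add_one hk)]
      · have hlt' : (k : ℕ) < j := hlt
        have hl : (vertexAdd k j 1 hlt' : ℕ) = k + 1 := rfl
        rw [(ih (d - 1) (by omega) k j (by omega)).2 _ hl hlt']
        refine altT_bracket hk ?_
        -- The remaining factor starts at k + 1 = i + 2, which is the bound that `altT_bracket`
        -- requires.
        have := (ih (d - 2) (by omega) (vertexAdd k j 1 hlt') j (by omega)).1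
        rwa [hl, hk] at this
    refine ⟨?_, key⟩
    rcases Nat.eq_zero_or_pos d with rfl | hd
    · obtain rfl : j = i := Subtype.ext h
      rw [X_self]
      exact E_mem_upperPart le_rfl
    · have hk : (vertexAdd i j 1 (by omega) : ℕ) = i + 1 := rfl
      rw [key _ hk (by rw [← Subtype.coe_le_coe, hk]; omega)]
      refine bracket_mem i (E_mem_upperPart le_rfl) (upperPart_anti (Nat.le_succ _) ?_)
      have := (ih (d - 1) (by omega) (vertexAdd i j 1 (by omega)) j (by omega)).1
      rwa [hk] at this

lemma X_mem_upperPart {i j : Vertex n} (h : i ≤ j) : X i j ∈ upperPart n i := by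
  have h' : (i : ℕ) ≤ j := h
  exact (X_mem_and_eq (j - i) i j (by omega)).1

lemma X_eq_bracket {i j k : Vertex n} (hk : (k : ℕ) = i + 1) (hkj : k ≤ j) :
    X i j = bracket i (X k j) := by
  have h' : (k : ℕ) ≤ j := hkj
  exact (X_mem_and_eq (j - i) i j (by omega)).2 k hk hkj

/-! ### Products of a word with a letter -/

namespace ShuffleAlgebra

/-- Shuffling one letter into a word means inserting it at some position p. The exponent counts
pairs whose letter from the left factor comes first, so here a is paired with the letters after it.
-/
lemma letter_mul_word (a : Vertex n) (u : List (Vertex n)) :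
    word [a] * word u = ∑ p ∈ Finset.range (u.length + 1),
      v ^ pair a (u.drop p) • word (u.take p ++ a :: u.drop p) := by
  induction u with
  | nil => simp [mul_one_aux, pair]
  | cons b u ih =>
    -- The insertion at p = 0 is the term of the recursion that begins with a; the positions p + 1
    -- are the insertions into the tail.
    rw [← cons_word b u, letter_mul_cons, ih, List.length_cons,
      Finset.sum_range_succ' _ (u.length + 1), map_sum, add_comm]
    simp

/-- Now a belongs to the right factor, so it is paired with the letters in front of it; symmetry of
the Cartan matrix allows the same notation `pair a`. -/
lemma word_mul_letter (a : Vertex n) (u : List (Vertex n)) :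
    word u * word [a] = ∑ p ∈ Finset.range (u.length + 1),
      v ^ pair a (u.take p) • word (u.take p ++ a :: u.drop p) := by
  induction u with
  | nil => simp [one_mul_aux, pair]
  | cons b u ih =>
    rw [cons_mul_cons, ih, List.length_cons, Finset.sum_range_succ' _ (u.length + 1), map_sum,
      mul_one_aux, Finset.smul_sum]
    simp [pair, cartan_comm b a, zpow_add₀ v_ne_zero, smul_smul]

/-- Only an occurrence of b contributes, with -1, and there is at most one. All other letters are
orthogonal to a. The hypothesis also excludes a itself from u, since a is not far from itself. -/
lemma pair_eq_of_nodup {a b : Vertex n} (hab : Adj a b) {u : List (Vertex n)} (hu : u.Nodup)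
    (h : ∀ c ∈ u, c ≠ b → Far a c) : pair a u = if b ∈ u then -1 else 0 := by
  induction u with
  | nil => simp [pair]
  | cons c u ih =>
    rw [List.nodup_cons] at hu
    have ih := ih hu.2 fun d hd => h d (List.mem_cons_of_mem _ hd)
    have hp : pair a (c :: u) = cartan a c + pair a u := by simp [pair]
    rw [hp, ih]
    by_cases hc : c = b
    · subst hc
      simp [hu.1, cartan_adj hab]
    · rw [cartan_far (h c List.mem_cons_self hc)]
      simp [Ne.symm hc]

lemma mem_drop_iff {α : Type*} {b : α} {u : List α} (hu : u.Nodup) (hb : b ∈ u) (p : ℕ) :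
    b ∈ u.drop p ↔ b ∉ u.take p := by
  have hd := hu
  rw [← List.take_append_drop p u, List.nodup_append] at hd
  rw [← List.take_append_drop p u, List.mem_append] at hb
  constructor
  · intro h1 h2
    exact hd.2.2 _ h2 _ h1 rfl
  · tauto

-- Compare coefficients of the insertion of a at position p. If b stands after a, the first product
-- gives 1 and the second v⁻¹, so the difference is 1 - v⁻². If b stands before a, they give v⁻¹ and
-- 1, and the difference v⁻¹ - v⁻¹ vanishes.
open Classical in
lemma word_bracket_before {a b : Vertex n} (hab : Adj a b) {u : List (Vertex n)}
    (hu : u.Nodup) (hb : b ∈ u) (h : ∀ c ∈ u, c ≠ b → Far a c) :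
    word u * word [a] - v⁻¹ • (word [a] * word u) =
    (1 - v ^ (-2 : ℤ)) • ∑ p ∈ (Finset.range (u.length + 1)).filter (fun p => b ∈ u.drop p),
      word (u.take p ++ a :: u.drop p) := by
  have h0 := v_ne_zero
  rw [word_mul_letter, letter_mul_word, Finset.smul_sum, ← Finset.sum_sub_distrib, Finset.smul_sum,
    Finset.sum_filter]
  refine Finset.sum_congr rfl fun p _ => ?_
  have h1 := mem_drop_iff hu hb p
  rw [pair_eq_of_nodup hab (hu.sublist (List.take_sublist p u))
      fun c hc => h c ((List.take_sublist p u).subset hc),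
    pair_eq_of_nodup hab (hu.sublist (List.drop_sublist p u))
      fun c hc => h c ((List.drop_sublist p u).subset hc)]
  by_cases h2 : b ∈ u.drop p
  · rw [if_neg (h1.1 h2), if_pos h2, if_pos h2]
    match_scalars
    rw [zpow_neg, zpow_neg, zpow_ofNat]
    field_simp
  · rw [if_pos (not_not.1 (mt h1.2 h2)), if_neg h2, if_neg h2]
    match_scalars
    rw [zpow_neg]
    field_simp
    simp

-- With the two products exchanged, the cancellation occurs when b stands after a, and the
-- insertions behind b survive.
open Classical in
lemma word_bracket_after {a b : Vertex n} (hab : Adj a b) {u : List (Vertex n)}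
    (hu : u.Nodup) (hb : b ∈ u) (h : ∀ c ∈ u, c ≠ b → Far a c) :
    word [a] * word u - v⁻¹ • (word u * word [a]) =
    (1 - v ^ (-2 : ℤ)) • ∑ p ∈ (Finset.range (u.length + 1)).filter (fun p => b ∈ u.take p),
      word (u.take p ++ a :: u.drop p) := by
  have h0 := v_ne_zero
  rw [word_mul_letter, letter_mul_word, Finset.smul_sum, ← Finset.sum_sub_distrib, Finset.smul_sum,
    Finset.sum_filter]
  refine Finset.sum_congr rfl fun p _ => ?_
  have h1 := mem_drop_iff hu hb p
  rw [pair_eq_of_nodup hab (hu.sublist (List.take_sublist p u))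
      fun c hc => h c ((List.take_sublist p u).subset hc),
    pair_eq_of_nodup hab (hu.sublist (List.drop_sublist p u))
      fun c hc => h c ((List.drop_sublist p u).subset hc)]
  by_cases h2 : b ∈ u.drop p
  · rw [if_neg (h1.1 h2), if_pos h2, if_neg (h1.1 h2)]
    match_scalars
    rw [zpow_neg]
    field_simp
    simp
  · have h3 := not_not.1 (mt h1.2 h2)
    rw [if_pos h3, if_neg h2, if_pos h3]
    match_scalars
    rw [zpow_neg, zpow_neg, zpow_ofNat]
    field_simp

end ShuffleAlgebra

/-! ### Words of alternating permutations -/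

/-- The word contains every vertex of `{i, …, j}` exactly once and no other letter, and no even
letter stands before one of its neighbours. -/
structure IsAltWord (i j : Vertex n) (u : List (Vertex n)) : Prop where
  nodup : u.Nodup
  mem_iff : ∀ c, c ∈ u ↔ i ≤ c ∧ c ≤ j
  pairwise : u.Pairwise fun x y : Vertex n => Even (x : ℕ) → ¬ Adj x y

lemma eq_add_one_of_adj {i k c : Vertex n} (hk : (k : ℕ) = i + 1) (hc : k ≤ c) (h : Adj i c) :
    c = k := by
  have hc' : (k : ℕ) ≤ c := hc
  apply Subtype.ext
  unfold Adj at h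
  rcases abs_cases (((i : ℕ) : ℤ) - ((c : ℕ) : ℤ)) with h' | h' <;> omega

-- In {i, …, j} the only neighbour of i is k, so inserting or deleting i affects the order
-- conditions only through the pair i, k. Exactly one of the two is even, and that one must come
-- second: k lies in front of i if i is even, and behind it if i is odd.
open Classical in
lemma isAltWord_insert_iff {i j k : Vertex n} (hk : (k : ℕ) = i + 1) (hkj : k ≤ j)
    {s t : List (Vertex n)} :
    IsAltWord i j (s ++ i :: t) ↔
      IsAltWord k j (s ++ t) ∧ if Even (i : ℕ) then k ∈ s else k ∈ t := by
  have hik : Adj i k := QuantumGroup.adj_of_eq_add_one hk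
  have hlt : ∀ c : Vertex n, k ≤ c ↔ i ≤ c ∧ c ≠ i := by
    intro c
    rw [← Subtype.coe_le_coe, ← Subtype.coe_le_coe, hk, Ne, Subtype.ext_iff]
    omega
  constructor
  · rintro ⟨h1, h2, h3⟩
    rw [List.nodup_middle, List.nodup_cons] at h1
    have hmem : ∀ c, c ∈ s ++ t ↔ k ≤ c ∧ c ≤ j := by
      intro c
      rw [hlt, and_right_comm, ← h2 c]
      constructor
      · intro hc
        refine ⟨?_, fun h => h1.1 (h ▸ hc)⟩
        simp only [List.mem_append, List.mem_cons] at hc ⊢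
        tauto
      · rintro ⟨hc, hc'⟩
        simp only [List.mem_append, List.mem_cons] at hc ⊢
        tauto
    refine ⟨⟨h1.2, hmem, h3.sublist ?_⟩, ?_⟩
    · exact (List.Sublist.refl s).append (List.sublist_cons_self i t)
    · have hks := (hmem k).2 ⟨le_rfl, hkj⟩
      rw [List.mem_append] at hks
      -- The condition on pairs forbids i in front of k when i is even, and k in front of i when k
      -- is even; so k is forced into the other piece.
      rw [List.pairwise_append, List.pairwise_cons] at h3
      split_ifs with hi
      · exact hks.resolve_right fun h => h3.2.1.1 k h hi hik
      · refine hks.resolve_left fun h => h3.2.2 k h i List.mem_cons_self ?_ (adj_comm.1 hik)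
        rw [hk]
        simpa [Nat.even_add_one] using hi
  · rintro ⟨⟨h1, h2, h3⟩, h4⟩
    have hi : i ∉ s ++ t := fun h => ((hlt i).1 ((h2 i).1 h).1).2 rfl
    refine ⟨?_, ?_, ?_⟩
    · rw [List.nodup_middle, List.nodup_cons]
      exact ⟨hi, h1⟩
    · intro c
      have hij : i ≤ j := le_trans ((hlt k).1 le_rfl).1 hkj
      have := h2 c
      rw [hlt, List.mem_append] at this
      rw [List.mem_append, List.mem_cons]
      by_cases hc : c = i
      · subst hc
        simp [hij]
      · tauto
    · have hd : ∀ c ∈ s, c ∉ t := fun c hc hc' => (List.nodup_append.1 h1).2.2 c hc c hc' rfl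
      -- The new pairs are those that contain i, and among them only the pair with k could violate
      -- the condition.
      have hks : ∀ c ∈ s ++ t, Adj i c → c = k := fun c hc =>
        eq_add_one_of_adj hk ((h2 c).1 hc).1
      rw [List.pairwise_append] at h3 ⊢
      refine ⟨h3.1, List.pairwise_cons.2 ⟨?_, h3.2.1⟩, ?_⟩
      · intro c hc hi' hic
        rw [if_pos hi'] at h4
        rw [hks c (List.mem_append_right _ hc) hic] at hc
        exact hd k h4 hc
      · intro c hc d hd'
        rcases List.mem_cons.1 hd' with rfl | hd'
        · intro hc' hcd
          have hck := hks c (List.mem_append_left _ hc) (adj_comm.1 hcd)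
          rw [hck, hk, Nat.even_add_one] at hc'
          rw [if_neg hc'] at h4
          rw [hck] at hc
          exact hd k hc h4
        · exact h3.2.2 c hc d hd'

/-! ### Permutations of an interval read as words -/

lemma vertexAdd_mem {i j : Vertex n} (p : Fin ((j : ℕ) + 1 - i)) :
    i ≤ vertexAdd i j p (by omega) ∧ vertexAdd i j p (by omega) ≤ j := by
  refine ⟨?_, ?_⟩ <;> rw [← Subtype.coe_le_coe] <;> simp only [vertexAdd] <;> omega

/-- The enumeration of `{i, …, j}` in increasing order. -/
def intervalEquiv (i j : Vertex n) : Fin ((j : ℕ) + 1 - i) ≃ Interval i j where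
  toFun p := ⟨vertexAdd i j p (by omega), vertexAdd_mem p⟩
  invFun c := ⟨(c : Vertex n) - i, by
    have h1 : (i : ℕ) ≤ (c : Vertex n) := c.2.1
    have h2 : ((c : Vertex n) : ℕ) ≤ j := c.2.2
    omega⟩
  left_inv p := by
    apply Fin.ext
    simp [vertexAdd]
  right_inv c := by
    have h1 : (i : ℕ) ≤ (c : Vertex n) := c.2.1
    apply Subtype.ext
    apply Subtype.ext
    simp only [vertexAdd]
    omega

lemma intervalEquiv_lt_iff {i j : Vertex n} (p q : Fin ((j : ℕ) + 1 - i)) :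
    intervalEquiv i j p < intervalEquiv i j q ↔ p < q := by
  change (i : ℕ) + p < i + q ↔ _
  rw [Fin.lt_def]
  omega

lemma permSeq_eq {i j : Vertex n} (π : Equiv.Perm (Interval i j)) :
    permSeq π = List.ofFn fun p => (π (intervalEquiv i j p) : Vertex n) := rfl

lemma permSeq_injective (i j : Vertex n) :
    Function.Injective (permSeq : Equiv.Perm (Interval i j) → List (Vertex n)) := by
  intro π ρ h
  rw [permSeq_eq, permSeq_eq] at h
  ext c : 1
  obtain ⟨p, rfl⟩ := (intervalEquiv i j).surjective c
  exact Subtype.ext (congrFun (List.ofFn_injective h) p)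

/-- This passes from letters to positions by substituting k = π a and l = π b. The conditions on k +
1 and k - 1 together concern all neighbours of an even letter. Since positions are linearly ordered
and neighbours are distinct, a greater position is the same as one that is not earlier. -/
lemma isAlternating_iff {i j : Vertex n} (π : Equiv.Perm (Interval i j)) :
    IsAlternating π ↔ ∀ a b : Interval i j, a < b →
      Even ((π a : Vertex n) : ℕ) → ¬ Adj (π a : Vertex n) (π b) := by
  have hadj : ∀ x y : Vertex n, Adj x y ↔ (y : ℕ) = x + 1 ∨ (y : ℕ) + 1 = x := by
    intro x y
    unfold Adj
    rcases abs_cases (((x : ℕ) : ℤ) - ((y : ℕ) : ℤ)) with h' | h' <;> omega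
  constructor
  · rintro ⟨h1, h2⟩ a b hab he had
    rcases (hadj _ _).1 had with h | h
    · have := h1 (π a) (π b) he h
      rw [Equiv.Perm.inv_def, Equiv.symm_apply_apply, Equiv.symm_apply_apply] at this
      exact lt_asymm this hab
    · have := h2 (π a) (π b) he h
      rw [Equiv.Perm.inv_def, Equiv.symm_apply_apply, Equiv.symm_apply_apply] at this
      exact lt_asymm this hab
  · intro h
    have key : ∀ k l : Interval i j, Even ((k : Vertex n) : ℕ) → Adj (k : Vertex n) l →
        π⁻¹ k > π⁻¹ l := by
      intro k l he had
      refine lt_of_not_ge fun hle => ?_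
      rcases hle.eq_or_lt with heq | hlt
      · exact had.ne (congrArg Subtype.val (π⁻¹.injective heq))
      · have := h _ _ hlt
        simp only [Equiv.Perm.inv_def, Equiv.apply_symm_apply] at this
        exact this he had
    exact ⟨fun k l he hkl => key k l he ((hadj _ _).2 (Or.inl hkl)),
      fun k l he hkl => key k l he ((hadj _ _).2 (Or.inr hkl))⟩

lemma pairwise_permSeq_iff {i j : Vertex n} (π : Equiv.Perm (Interval i j)) :
    (permSeq π).Pairwise (fun x y : Vertex n => Even (x : ℕ) → ¬ Adj x y) ↔ IsAlternating π := by
  rw [permSeq_eq, List.pairwise_ofFn, isAlternating_iff]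
  constructor
  · intro h a b hab
    obtain ⟨p, rfl⟩ := (intervalEquiv i j).surjective a
    obtain ⟨q, rfl⟩ := (intervalEquiv i j).surjective b
    exact h ((intervalEquiv_lt_iff p q).1 hab)
  · intro h p q hpq
    exact h _ _ ((intervalEquiv_lt_iff p q).2 hpq)

lemma nodup_permSeq {i j : Vertex n} (π : Equiv.Perm (Interval i j)) : (permSeq π).Nodup := by
  rw [permSeq_eq, List.nodup_ofFn]
  exact Subtype.val_injective.comp (π.injective.comp (intervalEquiv i j).injective)

lemma mem_permSeq {i j : Vertex n} (π : Equiv.Perm (Interval i j)) (c : Vertex n) :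
    c ∈ permSeq π ↔ i ≤ c ∧ c ≤ j := by
  rw [permSeq_eq, List.mem_ofFn]
  constructor
  · rintro ⟨p, rfl⟩
    exact (π _).2
  · intro hc
    refine ⟨(intervalEquiv i j).symm (π.symm ⟨c, hc⟩), ?_⟩
    simp

/-- A duplicate-free word with the right letters is a bijection from its positions to the interval;
composing it with the inverse of the increasing enumeration gives the permutation. -/
lemma exists_permSeq_eq {i j : Vertex n} {u : List (Vertex n)} (hu : u.Nodup)
    (hm : ∀ c, c ∈ u ↔ i ≤ c ∧ c ≤ j) : ∃ π : Equiv.Perm (Interval i j), permSeq π = u := by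
  let f : Fin u.length → Interval i j := fun p => ⟨u.get p, (hm _).1 (List.get_mem u p)⟩
  have hf : Function.Bijective f := by
    constructor
    · intro p q h
      exact List.nodup_iff_injective_get.1 hu (congrArg Subtype.val h)
    · rintro ⟨c, hc⟩
      obtain ⟨p, hp⟩ := List.get_of_mem ((hm c).2 hc)
      exact ⟨p, Subtype.ext hp⟩
  let e := Equiv.ofBijective f hf
  -- The length of u is not assumed; both index sets are in bijection with the interval.
  have hlen : (j : ℕ) + 1 - i = u.length := by
    simpa using Fintype.card_congr ((intervalEquiv i j).trans e.symm)
  refine ⟨(intervalEquiv i j).symm.trans ((finCongr hlen).trans e), ?_⟩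
  rw [permSeq_eq]
  refine (List.ofFn_congr hlen _).trans ?_
  conv_rhs => rw [← List.ofFn_get u]
  congr 1
  funext p
  simp [e, f]

/-! ### The set of alternating words and its recursion -/

open Classical in
/-- The words of the alternating permutations of `{i, …, j}`. -/
def altWords (i j : Vertex n) : Finset (List (Vertex n)) := (alternatingPerms i j).image permSeq

/-- From here on permutations are replaced by their words, for which inserting a letter needs no
change of the underlying symmetric group. -/
lemma mem_altWords {i j : Vertex n} {u : List (Vertex n)} : u ∈ altWords i j ↔ IsAltWord i j u := by
  unfold altWords alternatingPerms
  simp only [Finset.mem_image, Finset.mem_filter, Finset.mem_univ, true_and]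
  constructor
  · rintro ⟨π, hπ, rfl⟩
    exact ⟨nodup_permSeq π, mem_permSeq π, (pairwise_permSeq_iff π).2 hπ⟩
  · rintro ⟨h1, h2, h3⟩
    obtain ⟨π, rfl⟩ := exists_permSeq_eq h1 h2
    exact ⟨π, (pairwise_permSeq_iff π).1 h3, rfl⟩

lemma sum_alternatingPerms {M : Type*} [AddCommMonoid M] (i j : Vertex n)
    (f : List (Vertex n) → M) :
    ∑ π ∈ alternatingPerms i j, f (permSeq π) = ∑ u ∈ altWords i j, f u :=
  (Finset.sum_image fun _ _ _ _ h => permSeq_injective i j h).symm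

lemma altWords_self (i : Vertex n) : altWords i i = {[i]} := by
  ext u
  rw [mem_altWords, Finset.mem_singleton]
  constructor
  · rintro ⟨h1, h2, -⟩
    -- A duplicate-free word is determined up to order by its set of letters, and a single letter
    -- has only one order.
    refine List.perm_singleton.1 ((List.perm_ext_iff_of_nodup h1 (List.nodup_singleton i)).2 ?_)
    intro c
    rw [h2, List.mem_singleton, ← le_antisymm_iff, eq_comm]
  · rintro rfl
    refine ⟨List.nodup_singleton i, fun c => ?_, List.pairwise_singleton _ _⟩
    rw [List.mem_singleton, ← le_antisymm_iff, eq_comm]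

-- Deleting i from an alternating word of {i, …, j} and recording its position is a bijection onto
-- the pairs of an alternating word u of {k, …, j} and an admissible position. By
-- `isAltWord_insert_iff`, admissibility is the stated side condition on k.
open Classical in
lemma sum_altWords_insert {M : Type*} [AddCommMonoid M] {i j k : Vertex n} (hk : (k : ℕ) = i + 1)
    (hkj : k ≤ j) (f : List (Vertex n) → M) :
    ∑ u ∈ altWords i j, f u = ∑ u ∈ altWords k j,
      ∑ p ∈ (Finset.range (u.length + 1)).filter
        (fun p => if Even (i : ℕ) then k ∈ u.take p else k ∈ u.drop p),
        f (u.take p ++ i :: u.drop p) := by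
  rw [Finset.sum_sigma']
  symm
  have hi : ∀ u ∈ altWords k j, i ∉ u := by
    intro u hu h
    have : (k : ℕ) ≤ i := (((mem_altWords.1 hu).mem_iff i).1 h).1
    omega
  refine Finset.sum_bij (fun x _ => x.1.take x.2 ++ i :: x.1.drop x.2) ?_ ?_ ?_ ?_
  · rintro ⟨u, p⟩ h
    simp only [Finset.mem_sigma, Finset.mem_filter] at h
    rw [mem_altWords, isAltWord_insert_iff hk hkj, List.take_append_drop]
    exact ⟨mem_altWords.1 h.1, h.2.2⟩
  · rintro ⟨u, p⟩ h ⟨w, q⟩ h' heq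
    simp only [Finset.mem_sigma, Finset.mem_filter, Finset.mem_range] at h h'
    -- The letter i does not occur in u, so the new word can be cut at i in only one way, which
    -- recovers both pieces.
    have h1 : i ∉ u.take p := fun hm => hi u h.1 ((List.take_sublist p u).subset hm)
    have h2 : i ∉ u.drop p := fun hm => hi u h.1 ((List.drop_sublist p u).subset hm)
    obtain ⟨h3, -, h4⟩ : u.take p = w.take q ∧ i = i ∧ u.drop p = w.drop q :=
      (List.append_cons_inj_of_notMem h1 h2).1 heq
    obtain rfl : u = w := by
      rw [← List.take_append_drop p u, h3, h4, List.take_append_drop]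
    -- Positions do not exceed the length of the word, so the lengths of the initial pieces are p
    -- and q themselves.
    have h5 := congrArg List.length h3
    rw [List.length_take, List.length_take] at h5
    obtain rfl : p = q := by omega
    rfl
  · intro u hu
    rw [mem_altWords] at hu
    have hm : i ∈ u := (hu.mem_iff i).2 ⟨le_rfl, by
      have : (k : ℕ) ≤ j := hkj
      rw [← Subtype.coe_le_coe]
      omega⟩
    obtain ⟨s, t, rfl⟩ := List.append_of_mem hm
    rw [isAltWord_insert_iff hk hkj] at hu
    refine ⟨⟨s ++ t, s.length⟩, ?_, by simp⟩
    simp only [Finset.mem_sigma, Finset.mem_filter, Finset.mem_range, mem_altWords,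
      List.take_left, List.drop_left]
    exact ⟨hu.1, by simp, hu.2⟩
  · intro _ _
    rfl

/-! ### The image of `X_{i,j}` in the shuffle algebra -/

open ShuffleAlgebra QuantumGroup

open Classical in
lemma shuffleHom_bracket (i : Vertex n) (x : positivePart n) (hx : bracket i x ∈ positivePart n) :
    shuffleHom n ⟨bracket i x, hx⟩ =
      if Even (i : ℕ) then word [i] * shuffleHom n x - v⁻¹ • (shuffleHom n x * word [i])
      else shuffleHom n x * word [i] - v⁻¹ • (word [i] * shuffleHom n x) := by
  -- The homomorphism is defined on the subalgebra only, so the commutator is first written with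
  -- products of elements of the subalgebra.
  have h : (⟨bracket i x, hx⟩ : positivePart n) =
      if Even (i : ℕ) then posE i * x - v⁻¹ • (x * posE i)
      else x * posE i - v⁻¹ • (posE i * x) := by
    apply Subtype.ext
    unfold bracket
    split_ifs <;> rfl
  rw [h]
  split_ifs <;> simp only [map_sub, map_mul, map_smul, shuffleHom_E]

-- This is the inductive step in the shuffle algebra. Every word u of the sum contains k once, and
-- all its other letters are far from i, so the commutator with w[i] yields 1 - v⁻² times the
-- insertions of i on the admissible side of k. By `sum_altWords_insert`, over all u these run
-- through the alternating words of {i, …, j}, each once.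
open Classical in
lemma bracket_sum_altWords {i j k : Vertex n} (hk : (k : ℕ) = i + 1) (hkj : k ≤ j) :
    (if Even (i : ℕ) then word [i] * ∑ u ∈ altWords k j, word u -
        v⁻¹ • ((∑ u ∈ altWords k j, word u) * word [i])
      else (∑ u ∈ altWords k j, word u) * word [i] -
        v⁻¹ • (word [i] * ∑ u ∈ altWords k j, word u)) =
      (1 - v ^ (-2 : ℤ)) • ∑ u ∈ altWords i j, word u := by
  have hadj := adj_of_eq_add_one hk
  have hfar : ∀ u ∈ altWords k j, ∀ c ∈ u, c ≠ k → Far i c := by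
    intro u hu c hc hck
    have hkc := (((mem_altWords.1 hu).mem_iff c).1 hc).1
    refine far_of ?_ fun h => hck (eq_add_one_of_adj hk hkc h)
    rintro rfl
    have : (k : ℕ) ≤ i := hkc
    omega
  have hmem : ∀ u ∈ altWords k j, k ∈ u := fun u hu =>
    ((mem_altWords.1 hu).mem_iff k).2 ⟨le_rfl, hkj⟩
  rw [sum_altWords_insert hk hkj]
  split_ifs with hi
  · rw [Finset.mul_sum, Finset.sum_mul, Finset.smul_sum, ← Finset.sum_sub_distrib, Finset.smul_sum]
    exact Finset.sum_congr rfl fun u hu =>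
      word_bracket_after hadj (mem_altWords.1 hu).nodup (hmem u hu) (hfar u hu)
  · rw [Finset.mul_sum, Finset.sum_mul, Finset.smul_sum, ← Finset.sum_sub_distrib, Finset.smul_sum]
    exact Finset.sum_congr rfl fun u hu =>
      word_bracket_before hadj (mem_altWords.1 hu).nodup (hmem u hu) (hfar u hu)

/-! ### The formula by induction on j - i -/

lemma X_mem_positivePart {i j : Vertex n} (h : i ≤ j) : X i j ∈ positivePart n :=
  upperPart_le_positivePart _ (X_mem_upperPart h)

/-- The induction keeps j fixed and lowers i by one vertex at a time; each commutator supplies one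
factor 1 - v⁻². -/
lemma shuffleHom_X (d : ℕ) : ∀ (i j : Vertex n) (h : i ≤ j), (j : ℕ) = i + d →
    shuffleHom n ⟨X i j, X_mem_positivePart h⟩ =
      (1 - v ^ (-2 : ℤ)) ^ d • ∑ u ∈ altWords i j, word u := by
  induction d with
  | zero =>
    intro i j h hd
    obtain rfl : j = i := Subtype.ext hd
    have hX : (⟨X j j, X_mem_positivePart h⟩ : positivePart n) = posE j := Subtype.ext (X_self j)
    rw [hX, shuffleHom_E, altWords_self]
    simp
  | succ d ih =>
    intro i j h hd
    obtain ⟨k, hk⟩ : ∃ k : Vertex n, (k : ℕ) = i + 1 := ⟨vertexAdd i j 1 (by omega), rfl⟩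
    have hkj : k ≤ j := by
      rw [← Subtype.coe_le_coe]
      omega
    have hX := X_eq_bracket hk hkj
    -- The membership proof depends on the element, so the commutator formula is transported as an
    -- equality in the subalgebra.
    have hX' : (⟨X i j, X_mem_positivePart h⟩ : positivePart n) =
        ⟨bracket i (X k j), hX ▸ X_mem_positivePart h⟩ := Subtype.ext hX
    rw [hX', shuffleHom_bracket i ⟨X k j, X_mem_positivePart hkj⟩, ih k j hkj (by omega), pow_succ,
      mul_smul, ← bracket_sum_altWords hk hkj]
    -- In either order of the factors, the power of 1 - v⁻² from the induction hypothesis is a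
    -- scalar and comes out of the commutator.
    split_ifs <;> simp only [mul_smul_comm, smul_mul_assoc, smul_sub, smul_comm v⁻¹]

end QuantumShuffle
end

open QuantumShuffle
theorem mainTheorem5 {n : ℕ} (i j : Vertex n) (hij : i ≤ j) :
    ∃ hX : X i j ∈ QuantumGroup.positivePart n,
      shuffleHom n ⟨X i j, hX⟩ =
        (1 - v ^ (-2 : ℤ)) ^ ((j : ℕ) - (i : ℕ)) •
          ∑ π ∈ alternatingPerms i j, ShuffleAlgebra.word (permSeq π) := by
  have h : (i : ℕ) ≤ j := hij
  refine ⟨X_mem_positivePart hij, ?_⟩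
  rw [sum_alternatingPerms, shuffleHom_X (j - i) i j hij (by omega)]
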